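/- **Setting.** For $n\ge 0$ let $W_n$ be the Weyl group of type $B_n$: the group of permutations $\sigma$ of $\{-n,\dots,-1,0,1,\dots,n\}$ with $\sigma(-x)=-\sigma(x)$ for all $x$. Its simple reflections are $S=\{s_0,\dots,s_{n-1}\}$, where $s_0=(-1\ \,1)$ and $s_i=(i\ \,i{+}1)(-i\ \,{-i}{-}1)$ for $i>0$; $\ell$ is the Coxeter length. For $I\subset S$ let $W_I=\langle I\rangle$ be the parabolic subgroup, with longest element $w_I$. An $(I,J)$-coset is a double coset $p\in W_I\backslash W_n/W_J$, with minimal element $\underline p$ and maximal element $\overline p$. It is a *core coset* if $I\cap\underline pJ\underline p^{-1}=I$ and $\underline p^{-1}I\underline p\cap J=J$. For an $(I,J)$-coset $p$ and a $(J,K)$-coset $q$ put $p*q=W_I(\overline p*\overline q)W_K$, where $*$ on the right is the product in the Coxeter (0-Hecke) monoid. This composition is *reduced*, written $p.q$, if $\overline p*\overline q=(\overline pw_J^{-1})\,\overline q=\overline p\,(w_J^{-1}\overline q)$ and lengths add in both of these products of two factors. In a Coxeter group, $x.y$ denotes the product $xy$ when $\ell(xy)=\ell(x)+\ell(y)$ (a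 reduced composition). An $(I,J)$-expression is a sequence $[I=I_0,I_1,\dots,I_d=J]$ of subsets of $S$ in which consecutive members differ by adding or removing one simple reflection. It is a *reduced expression* for the $(I,J)$-coset $p$ if $\overline p=w_{I_0}\prod_i w_{I_{i-1}}^{-1}w_{I_i}$ and $\ell(\overline p)=\ell(w_{I_0})+\sum_i\bigl(\ell(w_{I_i})-\ell(w_{I_{i-1}})\bigr)$, where $i$ runs in order over the steps with $I_{i-1}\subset I_i$. An $(I,J)$-coset is *atomic* if it is a core coset with a reduced expression of the form $[I,I\cup\{s\},J]$, where $s\notin I$ and $J=(I\cup\{s\})\setminus\{t\}$. An *atomic reduced expression* for $p$ is a reduced expression $[I_0,K_1,I_1,K_2,\dots,K_r,I_r]$ for $p$ ($r\ge 0$) in which every $[I_{i-1},K_i,I_i]$ is a reduced expression of an atomic coset. For $J\subset S$ let $\sim_J$ be the equivalence relation on $\{-n,\dots,n\}$ generated by $j\sim_J j+1$ and $-j\sim_J -j-1$ for $s_j\in J$. With $k=n-\#J$, its classes are labelled in increasing order $C_{-k}^{(J)},\dots,C_0^{(J)},\dots,C_k^{(J)}$, with $0\in C_0^{(J)}$.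 An element $y\in W_n$ is a *block permutation* relative to $I$ and $J$ if each $C_c^{(J)}$ is sent by an order-preserving bijection onto some $C_{c'}^{(I)}$. If $\#I=\#J=n-k$, such a $y$ induces the permutation $\mathbb Sq(y)\colon c\mapsto c'$ of $\{-k,\dots,k\}$, which lies in $W_k$. For a core $(I,J)$-coset $p$ put $\mathbb Sq(p)=\mathbb Sq(\underline p)$. **Theorem.** Fix $J\subset S$ of size $m$ and let $k=n-m$. 1. If $p$ is a core $(I,J)$-coset, then $\#I=m$ and $\underline p$ is a block permutation relative to $I$ and $J$, so that $\mathbb Sq(p)\in W_k$ is defined. 2. If $p'$ is a core $(I,J)$-coset, $p''$ is a core $(J,K)$-coset and the composition $p=p'.p''$ is reduced, then $p$ is a core coset and $\mathbb Sq(p)=\mathbb Sq(p').\mathbb Sq(p'')$ is a reduced composition in $W_k$. 3. The map $(I,p)\mapsto\mathbb Sq(p)$ is a bijection from $\{(I,p)\mid I\subset S,\ p\text{ is a core }(I,J)\text{-coset}\}$ to $W_k$. 4. This bijection restricts to a bijection between the atomic $(I,J)$-cosets (as $I$ varies) and the simple reflections of $W_k$. 5. For every core $(I,J)$-coset $p$,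 the map which sends $[I_0,K_1,I_1,\dots,K_r,I_r]$ to the word $(\mathbb Sq(a_1),\dots,\mathbb Sq(a_r))$, where $a_i$ is the $(I_{i-1},I_i)$-coset containing $w_{K_i}$, is a bijection from the atomic reduced expressions for $p$ to the ordinary reduced expressions for $\mathbb Sq(p)$ in the simple reflections of $W_k$. -/

import Mathlib

noncomputable section

namespace TypeB

/-! ### The Weyl group of type `B_n` as a group of signed permutations -/

/-- The ordered set `{-n, …, -1, 0, 1, …, n}`. -/
abbrev Pt (n : ℕ) : Type := {x : ℤ // |x| ≤ (n : ℤ)}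

instance (n : ℕ) : Neg (Pt n) := ⟨fun x => ⟨-x.1, by rw [abs_neg]; exact x.2⟩⟩

instance (n : ℕ) : Finite (Pt n) := by
  refine ((Set.finite_Icc (-(n : ℤ)) (n : ℤ)).subset ?_ : Set.Finite {x : ℤ | |x| ≤ (n : ℤ)})
  intro x hx
  exact abs_le.mp hx

theorem Pt.coe_neg {n : ℕ} (x : Pt n) : ((-x : Pt n) : ℤ) = -(x : ℤ) := rfl

theorem Pt.neg_neg {n : ℕ} (x : Pt n) : - -x = x := Subtype.ext (_root_.neg_neg x.1)

theorem Pt.neg_inj {n : ℕ} {x y : Pt n} : -x = -y ↔ x = y :=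
  ⟨fun h => by rw [← Pt.neg_neg x, h, Pt.neg_neg], fun h => by rw [h]⟩

/-- The permutations `σ` of `{-n, …, n}` with `σ (-x) = - σ x`. -/
def weylGroup (n : ℕ) : Subgroup (Equiv.Perm (Pt n)) where
  carrier := {σ | ∀ x, σ (-x) = -σ x}
  mul_mem' := by
    intro a b ha hb
    change ∀ x, a (-x) = -a x at ha
    change ∀ x, b (-x) = -b x at hb
    change ∀ x, (a * b) (-x) = -(a * b) x
    intro x
    rw [Equiv.Perm.mul_apply, Equiv.Perm.mul_apply, hb, ha]
  one_mem' := fun _ => rfl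
  inv_mem' := by
    intro a ha
    change ∀ x, a (-x) = -a x at ha
    change ∀ x, a⁻¹ (-x) = -a⁻¹ x
    intro x
    rw [Equiv.Perm.inv_eq_iff_eq, ha]
    simp

/-- The Weyl group of type `B_n`. -/
abbrev W (n : ℕ) : Type := weylGroup n

/-- The point `i` of `{-n, …, n}` for `0 ≤ i < n`. -/
def pt {n : ℕ} (i : Fin n) : Pt n := ⟨(i : ℤ), by
  have := i.2
  rw [abs_of_nonneg (by positivity)]; omega⟩

/-- The point `i + 1` of `{-n, …, n}` for `0 ≤ i < n`. -/
def ptSucc {n : ℕ} (i : Fin n) : Pt n := ⟨(i : ℤ) + 1, by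
  have := i.2
  rw [abs_of_nonneg (by positivity)]; omega⟩

/-- The permutation `(-1 1)` if `i = 0`, and `(i i+1)(-i -i-1)` if `i > 0`. -/
def simplePerm {n : ℕ} (i : Fin n) : Equiv.Perm (Pt n) :=
  if (i : ℕ) = 0 then Equiv.swap (-ptSucc i) (ptSucc i)
  else Equiv.swap (pt i) (ptSucc i) * Equiv.swap (-pt i) (-ptSucc i)

theorem swap_neg {n : ℕ} (a b x : Pt n) :
    Equiv.swap a b (-x) = -Equiv.swap (-a) (-b) x := by
  have h1 : ∀ c : Pt n, (-x = c) ↔ (x = -c) := fun c => by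
    rw [← Pt.neg_inj, Pt.neg_neg]
  rw [Equiv.swap_apply_def, Equiv.swap_apply_def]
  simp only [h1]
  split_ifs <;> simp [Pt.neg_neg]

theorem simplePerm_mem {n : ℕ} (i : Fin n) : simplePerm i ∈ weylGroup n := by
  intro x
  unfold simplePerm
  split_ifs with h
  · rw [swap_neg, Pt.neg_neg, Equiv.swap_comm]
  · have hd : Equiv.swap (pt i) (ptSucc i) * Equiv.swap (-pt i) (-ptSucc i)
        = Equiv.swap (-pt i) (-ptSucc i) * Equiv.swap (pt i) (ptSucc i) := by
      apply Equiv.Perm.Disjoint.commute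
      have e1 : pt i ≠ -pt i := fun e => h (by have := congrArg Subtype.val e; simp [pt, Pt.coe_neg] at this; omega)
      have e2 : pt i ≠ -ptSucc i := fun e => by
        have := congrArg Subtype.val e; simp [pt, ptSucc, Pt.coe_neg] at this; omega
      have e3 : ptSucc i ≠ -pt i := fun e => by
        have := congrArg Subtype.val e; simp [pt, ptSucc, Pt.coe_neg] at this; omega
      have e4 : ptSucc i ≠ -ptSucc i := fun e => by
        have := congrArg Subtype.val e; simp [ptSucc, Pt.coe_neg] at this; omega
      intro z
      by_cases hz : z = pt i ∨ z = ptSucc i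
      · right
        rcases hz with rfl | rfl
        · exact Equiv.swap_apply_of_ne_of_ne e1 e2
        · exact Equiv.swap_apply_of_ne_of_ne e3 e4
      · left
        push Not at hz
        exact Equiv.swap_apply_of_ne_of_ne hz.1 hz.2
    rw [Equiv.Perm.mul_apply, swap_neg, swap_neg, Pt.neg_neg, Pt.neg_neg,
      ← Equiv.Perm.mul_apply, ← hd]

/-- The simple reflections `s_0, …, s_{n-1}`. -/
def simple {n : ℕ} (i : Fin n) : W n := ⟨simplePerm i, simplePerm_mem i⟩

/-- The Coxeter length: the least length of a word in the simple reflections with product `w`. -/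
def len {n : ℕ} (w : W n) : ℕ :=
  sInf {d | ∃ ω : List (Fin n), ω.length = d ∧ (ω.map simple).prod = w}

/-- `w` is a product of a word `ω` of length `len w`. -/
def IsReducedWord {n : ℕ} (w : W n) (ω : List (Fin n)) : Prop :=
  (ω.map simple).prod = w ∧ ω.length = len w

open scoped Classical in
/-- A chosen reduced word of `w`. -/
def reducedWord {n : ℕ} (w : W n) : List (Fin n) :=
  if h : ∃ ω, IsReducedWord w ω then h.choose else []

/-- The product `s_i * w` in the Coxeter (0-Hecke) monoid: the longer one of `s_i w` and `w`. -/
def starSimple {n : ℕ} (i : Fin n) (w : W n) : W n :=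
  if len w < len (simple i * w) then simple i * w else w

/-- The product `x * y` in the Coxeter (0-Hecke) monoid, whose underlying set is identified with
`W n`. It does not depend on the chosen reduced word of `x`. -/
def star {n : ℕ} (x y : W n) : W n := (reducedWord x).foldr starSimple y

open scoped Classical in
/-- The element of minimal length of a set (used for double cosets, where it is unique). -/
def minElt {n : ℕ} (A : Set (W n)) : W n :=
  if h : A.Nonempty then (Set.exists_min_image A len A.toFinite h).choose else 1

open scoped Classical in
/-- The element of maximal length of a set (used for double cosets and parabolic subgroups,
where it is unique). -/
def maxElt {n : ℕ} (A : Set (W n)) : W n :=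
  if h : A.Nonempty then (Set.exists_max_image A len A.toFinite h).choose else 1

/-! ### Double cosets, core cosets, atomic cosets

Subsets of `S = {s_0, …, s_{n-1}}` are written as sets of indices. -/

/-- The parabolic subgroup `W_I`. -/
def parabolic {n : ℕ} (I : Finset (Fin n)) : Subgroup (W n) :=
  Subgroup.closure (simple '' (I : Set (Fin n)))

/-- The longest element `w_I` of `W_I`. -/
def longest {n : ℕ} (I : Finset (Fin n)) : W n := maxElt (parabolic I : Set (W n))

/-- An `(I,J)`-coset: an element of `W_I \ W / W_J`. -/
@[ext] structure Coset {n : ℕ} (I J : Finset (Fin n)) where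
  carrier : Set (W n)
  isDoubleCoset : ∃ w : W n,
    carrier = DoubleCoset.doubleCoset w (parabolic I : Set (W n)) (parabolic J : Set (W n))

/-- The `(I,J)`-coset containing `w`. -/
def cosetOf {n : ℕ} (I J : Finset (Fin n)) (w : W n) : Coset I J :=
  ⟨DoubleCoset.doubleCoset w (parabolic I : Set (W n)) (parabolic J : Set (W n)), w, rfl⟩

namespace Coset

variable {n : ℕ} {I J K : Finset (Fin n)}

/-- The minimal element of a double coset. -/
def min (p : Coset I J) : W n := minElt p.carrier

/-- The maximal element of a double coset. -/
def max (p : Coset I J) : W n := maxElt p.carrier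

/-- The left redundancy `I ∩ p_min J p_min⁻¹`. -/
def leftRed (p : Coset I J) : Set (Fin n) :=
  {i | i ∈ I ∧ ∃ j ∈ J, simple i = p.min * simple j * p.min⁻¹}

/-- The right redundancy `p_min⁻¹ I p_min ∩ J`. -/
def rightRed (p : Coset I J) : Set (Fin n) :=
  {j | j ∈ J ∧ ∃ i ∈ I, simple j = p.min⁻¹ * simple i * p.min}

/-- `p` is a core coset. -/
def IsCore (p : Coset I J) : Prop :=
  p.leftRed = (I : Set (Fin n)) ∧ p.rightRed = (J : Set (Fin n))

/-- The composition `p * q = W_I (p_max * q_max) W_K` in the singular Coxeter monoid. -/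
def comp (p : Coset I J) (q : Coset J K) : Coset I K := cosetOf I K (star p.max q.max)

/-- The composition `p * q` is reduced:
`(p_max w_J⁻¹) . q_max = p_max * q_max = p_max . (w_J⁻¹ q_max)`, where `x . y` stands for the
product `x y` together with the assertion that the lengths of `x` and `y` add up. -/
def IsReducedComp (p : Coset I J) (q : Coset J K) : Prop :=
  p.max * (longest J)⁻¹ * q.max = star p.max q.max ∧
  len (p.max * (longest J)⁻¹ * q.max) = len (p.max * (longest J)⁻¹) + len q.max ∧
  len (p.max * (longest J)⁻¹ * q.max) = len p.max + len ((longest J)⁻¹ * q.max)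

end Coset

/-! ### Expressions -/

/-- `K` arises from `I` by adding or removing one simple reflection. -/
def IsStep {n : ℕ} (I K : Finset (Fin n)) : Prop :=
  (∃ s, s ∉ I ∧ K = insert s I) ∨ (∃ s, s ∈ I ∧ K = I.erase s)

/-- `[I_0, …, I_d]` is a (singlestep) `(I,J)`-expression. -/
def IsExpr {n : ℕ} (I J : Finset (Fin n)) (L : List (Finset (Fin n))) : Prop :=
  L.head? = some I ∧ L.getLast? = some J ∧ L.IsChain IsStep

/-- The product of `w_I⁻¹ w_K` over all ascending steps `I ⊂ K` of the expression. -/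
def stepProd {n : ℕ} : List (Finset (Fin n)) → W n
  | I :: K :: L => (if I ⊆ K then (longest I)⁻¹ * longest K else 1) * stepProd (K :: L)
  | _ => 1

/-- The sum of `ℓ(w_K) - ℓ(w_I)` over all ascending steps `I ⊂ K` of the expression. -/
def stepLen {n : ℕ} : List (Finset (Fin n)) → ℤ
  | I :: K :: L =>
      (if I ⊆ K then (len (longest K) : ℤ) - len (longest I) else 0) + stepLen (K :: L)
  | _ => 0

/-- `L` is a reduced expression for the `(I,J)`-coset `p`. If `L` refines
`[[I = I_0 ⊂ K_1 ⊃ I_1 ⊂ ⋯ ⊂ K_r ⊃ I_r = J]]`, then the two equations read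
`p_max = w_{K_1} w_{I_1}⁻¹ w_{K_2} ⋯ w_{K_r}` and
`ℓ(p_max) = ℓ(w_{K_1}) - ℓ(w_{I_1}) + ℓ(w_{K_2}) - ⋯ + ℓ(w_{K_r})`. -/
def IsReducedExpr {n : ℕ} {I J : Finset (Fin n)} (p : Coset I J)
    (L : List (Finset (Fin n))) : Prop :=
  IsExpr I J L ∧ p.max = longest I * stepProd L ∧
    (len p.max : ℤ) = len (longest I) + stepLen L

/-- `p` is an atomic coset: a core coset with a reduced expression `[I + s - t] = [I, Is, J]`. -/
def Coset.IsAtomic {n : ℕ} {I J : Finset (Fin n)} (p : Coset I J) : Prop :=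
  p.IsCore ∧ ∃ s t : Fin n, s ∉ I ∧ t ∈ insert s I ∧
    IsReducedExpr p [I, insert s I, (insert s I).erase t]

/-- The expressions `[I_0, K_1, I_1, K_2, …, K_r, I_r]` such that each `[I_{i-1}, K_i, I_i]` is the
reduced expression of an atomic coset. -/
inductive IsAtomicExpr {n : ℕ} : List (Finset (Fin n)) → Prop
  | base (I : Finset (Fin n)) : IsAtomicExpr [I]
  | cons (I K I' : Finset (Fin n)) (L : List (Finset (Fin n))) (a : Coset I I')
      (ha : a.IsAtomic) (hK : IsReducedExpr a [I, K, I']) (hL : IsAtomicExpr (I' :: L)) :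
      IsAtomicExpr (I :: K :: I' :: L)

/-- `L` is an atomic reduced expression for `p`. -/
def IsAtomicReducedExpr {n : ℕ} {I J : Finset (Fin n)} (p : Coset I J)
    (L : List (Finset (Fin n))) : Prop :=
  IsReducedExpr p L ∧ IsAtomicExpr L

/-! ### Components and their labels -/

/-- The relations `j ∼ j + 1` and `-j ∼ -j - 1` for `s_j ∈ J`. -/
def adjRel {n : ℕ} (J : Finset (Fin n)) (x y : Pt n) : Prop :=
  ∃ j ∈ J, (x = pt j ∧ y = ptSucc j) ∨ (x = -pt j ∧ y = -ptSucc j)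

/-- The equivalence relation `∼_J` on `{-n, …, n}`; its classes are the components. -/
def compSetoid {n : ℕ} (J : Finset (Fin n)) : Setoid (Pt n) := Relation.EqvGen.setoid (adjRel J)

/-- The component of `x`. -/
def component {n : ℕ} (J : Finset (Fin n)) (x : Pt n) : Set (Pt n) := {z | compSetoid J z x}

/-- The number of `d` with `0 ≤ d < a` and `s_d ∉ J`. -/
def gaps {n : ℕ} (J : Finset (Fin n)) (a : ℕ) : ℕ :=
  (Finset.univ.filter fun d : Fin n => d ∉ J ∧ (d : ℕ) < a).card

/-- The label `c` of the component `C_c` of `x`, where the components are labelled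
`C_{-k}, …, C_{-1}, C_0, C_1, …, C_k` in increasing order and `C_0` contains `0`; the facts below
show that this is that labelling. -/
def labelInt {n : ℕ} (J : Finset (Fin n)) (x : Pt n) : ℤ := Int.sign x.1 * gaps J x.1.natAbs

theorem gaps_zero {n : ℕ} (J : Finset (Fin n)) : gaps J 0 = 0 := by simp [gaps]

theorem gaps_mono {n : ℕ} (J : Finset (Fin n)) : Monotone (gaps J) := by
  intro a b hab
  apply Finset.card_le_card
  intro d
  simp only [Finset.mem_filter, Finset.mem_univ, true_and]
  exact fun h => ⟨h.1, by omega⟩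

theorem gaps_top {n : ℕ} (J : Finset (Fin n)) : J.card + gaps J n = n := by
  have h : (Finset.univ.filter fun d : Fin n => d ∉ J ∧ (d : ℕ) < n) = Jᶜ := by
    ext d; simp
  unfold gaps
  rw [h, Finset.card_add_card_compl, Fintype.card_fin]

theorem gaps_succ {n : ℕ} (J : Finset (Fin n)) (d : Fin n) :
    gaps J (d + 1) = if d ∈ J then gaps J d else gaps J d + 1 := by
  unfold gaps
  split_ifs with h
  · congr 1
    ext e
    simp only [Finset.mem_filter, Finset.mem_univ, true_and, and_congr_right_iff]
    intro he
    have : (e : ℕ) ≠ d := fun hh => he (by rwa [Fin.ext hh])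
    omega
  · rw [← Finset.card_insert_of_notMem (a := d)]
    · congr 1
      ext e
      simp only [Finset.mem_filter, Finset.mem_univ, true_and, Finset.mem_insert]
      constructor
      · rintro ⟨h1, h2⟩
        by_cases hh : (e : ℕ) = d
        · exact Or.inl (Fin.ext hh)
        · exact Or.inr ⟨h1, by omega⟩
      · rintro (rfl | ⟨h1, h2⟩)
        · exact ⟨h, by omega⟩
        · exact ⟨h1, by omega⟩
    · simp

theorem labelInt_neg {n : ℕ} (J : Finset (Fin n)) (x : Pt n) :
    labelInt J (-x) = -labelInt J x := by
  simp [labelInt, Pt.coe_neg]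

theorem labelInt_of_nonneg {n : ℕ} (J : Finset (Fin n)) {x : Pt n} (hx : 0 ≤ x.1) :
    labelInt J x = gaps J x.1.natAbs := by
  rcases hx.eq_or_lt with h | h
  · rw [labelInt, ← h]; simp [gaps_zero]
  · rw [labelInt, Int.sign_eq_one_of_pos h, one_mul]

theorem labelInt_of_nonpos {n : ℕ} (J : Finset (Fin n)) {x : Pt n} (hx : x.1 ≤ 0) :
    labelInt J x = -gaps J x.1.natAbs := by
  have := labelInt_of_nonneg J (x := -x) (by rw [Pt.coe_neg]; omega)
  rw [labelInt_neg, Pt.coe_neg, Int.natAbs_neg] at this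
  omega

theorem labelInt_mono {n : ℕ} (J : Finset (Fin n)) {x y : Pt n} (h : x ≤ y) :
    labelInt J x ≤ labelInt J y := by
  have h' : x.1 ≤ y.1 := h
  rcases le_total 0 x.1 with hx | hx
  · rw [labelInt_of_nonneg J hx, labelInt_of_nonneg J (hx.trans h')]
    exact_mod_cast gaps_mono J (by omega)
  · rcases le_total 0 y.1 with hy | hy
    · rw [labelInt_of_nonpos J hx, labelInt_of_nonneg J hy]
      omega
    · rw [labelInt_of_nonpos J hx, labelInt_of_nonpos J hy]
      have := gaps_mono J (a := y.1.natAbs) (b := x.1.natAbs) (by omega)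
      omega

theorem compSetoid_neg {n : ℕ} {J : Finset (Fin n)} {x y : Pt n} (h : compSetoid J x y) :
    compSetoid J (-x) (-y) := by
  change Relation.EqvGen (adjRel J) x y at h
  change Relation.EqvGen (adjRel J) (-x) (-y)
  induction h with
  | rel x y h =>
    obtain ⟨j, hj, ⟨rfl, rfl⟩ | ⟨rfl, rfl⟩⟩ := h
    · exact .rel _ _ ⟨j, hj, Or.inr ⟨rfl, rfl⟩⟩
    · exact .rel _ _ ⟨j, hj, Or.inl ⟨Pt.neg_neg _, Pt.neg_neg _⟩⟩
  | refl x => exact .refl _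
  | symm x y _ ih => exact .symm _ _ ih
  | trans x y z _ _ ih1 ih2 => exact .trans _ _ _ ih1 ih2

theorem labelInt_ptSucc {n : ℕ} {J : Finset (Fin n)} {j : Fin n} (hj : j ∈ J) :
    labelInt J (pt j) = labelInt J (ptSucc j) := by
  rw [labelInt_of_nonneg J (x := pt j) (by simp [pt]),
    labelInt_of_nonneg J (x := ptSucc j) (by simp only [ptSucc]; omega)]
  have h1 : (pt j).1.natAbs = j := by simp [pt]
  have h2 : (ptSucc j).1.natAbs = j + 1 := by simp only [ptSucc]; omega
  rw [h1, h2, gaps_succ, if_pos hj]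

theorem compSetoid_of_gaps {n : ℕ} {J : Finset (Fin n)} (a b : ℕ) (ha : a ≤ n) (hab : a + b ≤ n)
    (h : gaps J a = gaps J (a + b)) :
    compSetoid J ⟨(a : ℤ), by rw [abs_of_nonneg (by positivity)]; omega⟩
      ⟨((a + b : ℕ) : ℤ), by rw [abs_of_nonneg (by positivity)]; omega⟩ := by
  induction b with
  | zero => exact .refl _
  | succ b ih =>
    have h1 := gaps_mono J (show a ≤ a + b by omega)
    have h2 := gaps_mono J (show a + b ≤ a + (b + 1) by omega)
    have hJ : (⟨a + b, by omega⟩ : Fin n) ∈ J := by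
      by_contra hn
      have := gaps_succ J ⟨a + b, by omega⟩
      rw [if_neg hn] at this
      simp only at this
      rw [← add_assoc] at h
      omega
    refine .trans _ _ _ (ih (by omega) (by omega)) (.rel _ _ ⟨_, hJ, Or.inl ⟨?_, ?_⟩⟩)
    · apply Subtype.ext; simp [pt]
    · apply Subtype.ext; simp [ptSucc]; ring

theorem compSetoid_of_nonneg {n : ℕ} {J : Finset (Fin n)} {x y : Pt n} (hx : 0 ≤ x.1)
    (hxy : x.1 ≤ y.1) (h : labelInt J x = labelInt J y) : compSetoid J x y := by
  rw [labelInt_of_nonneg J hx, labelInt_of_nonneg J (hx.trans hxy)] at h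
  have hy := abs_le.mp y.2
  have e : x.1.natAbs + (y.1.natAbs - x.1.natAbs) = y.1.natAbs := by omega
  have := compSetoid_of_gaps (J := J) x.1.natAbs (y.1.natAbs - x.1.natAbs) (by omega) (by omega)
    (by rw [e]; exact_mod_cast h)
  convert this using 1
  · apply Subtype.ext; simp only; omega
  · apply Subtype.ext; simp only; omega

/-- Two points have the same label exactly if they lie in the same component. -/
theorem labelInt_eq_iff {n : ℕ} (J : Finset (Fin n)) (x y : Pt n) :
    labelInt J x = labelInt J y ↔ compSetoid J x y := by
  constructor
  · intro h
    have key : ∀ x y : Pt n, 0 ≤ x.1 → 0 ≤ y.1 → labelInt J x = labelInt J y →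
        compSetoid J x y := by
      intro x y hx hy h
      rcases le_total x.1 y.1 with hxy | hxy
      · exact compSetoid_of_nonneg hx hxy h
      · exact (compSetoid J).symm (compSetoid_of_nonneg hy hxy h.symm)
    have keyneg : ∀ x y : Pt n, x.1 ≤ 0 → y.1 ≤ 0 → labelInt J x = labelInt J y →
        compSetoid J x y := by
      intro x y hx hy h
      have := compSetoid_neg (key (-x) (-y) (by rw [Pt.coe_neg]; omega)
        (by rw [Pt.coe_neg]; omega) (by rw [labelInt_neg, labelInt_neg, h]))
      rwa [Pt.neg_neg, Pt.neg_neg] at this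
    have keymix : ∀ x y : Pt n, x.1 ≤ 0 → 0 ≤ y.1 → labelInt J x = labelInt J y →
        compSetoid J x y := by
      intro x y hx hy h
      let z : Pt n := ⟨0, by simp⟩
      have hz : labelInt J z = 0 := by simp [labelInt, z]
      have h1 := labelInt_of_nonpos J hx
      have h2 := labelInt_of_nonneg J hy
      exact (compSetoid J).trans (keyneg x z hx le_rfl (by omega)) (key z y le_rfl hy (by omega))
    rcases le_total 0 x.1 with hx | hx <;> rcases le_total 0 y.1 with hy | hy
    · exact key x y hx hy h
    · exact (compSetoid J).symm (keymix y x hy hx h.symm)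
    · exact keymix x y hx hy h
    · exact keyneg x y hx hy h
  · intro h
    change Relation.EqvGen (adjRel J) x y at h
    induction h with
    | rel x y h =>
      obtain ⟨j, hj, ⟨rfl, rfl⟩ | ⟨rfl, rfl⟩⟩ := h
      · exact labelInt_ptSucc hj
      · rw [labelInt_neg, labelInt_neg, labelInt_ptSucc hj]
    | refl x => rfl
    | symm x y _ ih => exact ih.symm
    | trans x y z _ _ ih1 ih2 => exact ih1.trans ih2

/-- The label as an element of `{-k, …, k}`, where `k = n - #J`. -/
def label {n k : ℕ} (J : Finset (Fin n)) (hJ : J.card + k = n) (x : Pt n) : Pt k :=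
  ⟨labelInt J x, by
    have h1 := gaps_top J
    have hx := abs_le.mp x.2
    have h2 := gaps_mono J (show x.1.natAbs ≤ n by omega)
    rw [abs_le]
    rcases le_total 0 x.1 with h | h
    · rw [labelInt_of_nonneg J h]; omega
    · rw [labelInt_of_nonpos J h]; omega⟩

theorem label_neg {n k : ℕ} (J : Finset (Fin n)) (hJ : J.card + k = n) (x : Pt n) :
    label J hJ (-x) = -label J hJ x := Subtype.ext (labelInt_neg J x)

theorem gaps_surj {n : ℕ} (J : Finset (Fin n)) (b : ℕ) (hb : b ≤ n) (c : ℕ) (hc : c ≤ gaps J b) :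
    ∃ a ≤ n, gaps J a = c := by
  induction b with
  | zero => exact ⟨0, hb, by rw [gaps_zero] at hc ⊢; omega⟩
  | succ b ih =>
    by_cases h : c = gaps J (b + 1)
    · exact ⟨b + 1, hb, h.symm⟩
    · refine ih (by omega) ?_
      have := gaps_succ J ⟨b, by omega⟩
      simp only at this
      split_ifs at this <;> omega

theorem label_surjective {n k : ℕ} (J : Finset (Fin n)) (hJ : J.card + k = n) :
    Function.Surjective (label J hJ) := by
  have key : ∀ c : Pt k, 0 ≤ c.1 → ∃ x, label J hJ x = c := by
    intro c hc
    have h1 := gaps_top J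
    have h2 := abs_le.mp c.2
    obtain ⟨a, ha, hac⟩ := gaps_surj J n le_rfl c.1.natAbs (by omega)
    refine ⟨⟨(a : ℤ), by rw [abs_of_nonneg (by positivity)]; omega⟩, Subtype.ext ?_⟩
    change labelInt J _ = _
    rw [labelInt_of_nonneg J (by simp)]
    simp only [Int.natAbs_natCast, hac]
    omega
  intro c
  rcases le_total 0 c.1 with h | h
  · exact key c h
  · obtain ⟨x, hx⟩ := key (-c) (by rw [Pt.coe_neg]; omega)
    exact ⟨-x, by rw [label_neg, hx, Pt.neg_neg]⟩

/-- The identification of the set of components with `{-k, …, k}`. -/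
def labelEquiv {n k : ℕ} (J : Finset (Fin n)) (hJ : J.card + k = n) :
    Quotient (compSetoid J) ≃ Pt k :=
  Equiv.ofBijective
    (Quotient.lift (label J hJ) fun x y h => Subtype.ext ((labelInt_eq_iff J x y).mpr h)) <| by
    constructor
    · intro a b
      induction a using Quotient.inductionOn with | _ x =>
      induction b using Quotient.inductionOn with | _ y =>
      intro h
      exact Quotient.sound ((labelInt_eq_iff J x y).mp (congrArg Subtype.val h))
    · intro c
      obtain ⟨x, hx⟩ := label_surjective J hJ c
      exact ⟨Quotient.mk _ x, hx⟩

theorem labelEquiv_mk {n k : ℕ} (J : Finset (Fin n)) (hJ : J.card + k = n) (x : Pt n) :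
    labelEquiv J hJ (Quotient.mk _ x) = label J hJ x := rfl

/-! ### Squashing -/

/-- `y` is a block permutation relative to `I` and `J`: each component of `J` is sent by an
order-preserving bijection onto a component of `I`. -/
structure IsBlock {n : ℕ} (I J : Finset (Fin n)) (y : W n) : Prop where
  image_eq : ∀ x, y.1 '' component J x = component I (y.1 x)
  strictMonoOn : ∀ x, StrictMonoOn y.1 (component J x)

theorem IsBlock.compSetoid_iff {n : ℕ} {I J : Finset (Fin n)} {y : W n} (h : IsBlock I J y)
    (a b : Pt n) : compSetoid J a b ↔ compSetoid I (y.1 a) (y.1 b) := by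
  have := h.image_eq b
  constructor
  · intro hab
    exact (this.subset ⟨a, hab, rfl⟩ : y.1 a ∈ component I (y.1 b))
  · intro hab
    obtain ⟨c, hc, hca⟩ := this.superset (show y.1 a ∈ component I (y.1 b) from hab)
    rwa [← y.1.injective hca]

/-- The permutation of `{-k, …, k}` induced by a block permutation on the sets of components. -/
def squashPerm {n k : ℕ} {I J : Finset (Fin n)} (hI : I.card + k = n) (hJ : J.card + k = n)
    {y : W n} (h : IsBlock I J y) : Equiv.Perm (Pt k) :=
  (labelEquiv J hJ).symm.trans
    ((Quotient.congr y.1 h.compSetoid_iff).trans (labelEquiv I hI))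

theorem squashPerm_label {n k : ℕ} {I J : Finset (Fin n)} (hI : I.card + k = n)
    (hJ : J.card + k = n) {y : W n} (h : IsBlock I J y) (x : Pt n) :
    squashPerm hI hJ h (label J hJ x) = label I hI (y.1 x) := by
  simp only [squashPerm, Equiv.trans_apply]
  rw [← labelEquiv_mk J hJ x, Equiv.symm_apply_apply]
  rfl

theorem squashPerm_mem {n k : ℕ} {I J : Finset (Fin n)} (hI : I.card + k = n)
    (hJ : J.card + k = n) {y : W n} (h : IsBlock I J y) : squashPerm hI hJ h ∈ weylGroup k := by
  intro c
  obtain ⟨x, rfl⟩ := label_surjective J hJ c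
  rw [← label_neg, squashPerm_label, squashPerm_label, y.2 x, label_neg]

open scoped Classical in
/-- The squashed permutation of a core `(I,J)`-coset with `#I = #J = n - k` (and `1` if this makes
no sense because the minimal element is not a block permutation). -/
def squash {n : ℕ} (k : ℕ) {I J : Finset (Fin n)} (p : Coset I J) : W k :=
  if h : I.card + k = n ∧ J.card + k = n ∧ IsBlock I J p.min then
    ⟨squashPerm h.1 h.2.1 h.2.2, squashPerm_mem h.1 h.2.1 h.2.2⟩
  else 1

/-- Squashing an atomic expression `[I_0, K_1, I_1, …, K_r, I_r]` to the word of the squashed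
permutations of the cosets expressed by `[I_{i-1}, K_i, I_i]`. -/
def squashExpr {n : ℕ} (k : ℕ) : List (Finset (Fin n)) → List (W k)
  | I :: K :: I' :: L => squash k (cosetOf I I' (longest K)) :: squashExpr k (I' :: L)
  | _ => []

/-- `ω` is a reduced expression of `w` as a product of simple reflections. -/
def IsOrdinaryReducedExpr {k : ℕ} (w : W k) (ω : List (W k)) : Prop :=
  (∀ s ∈ ω, s ∈ Set.range (simple : Fin k → W k)) ∧ ω.prod = w ∧ ω.length = len w

end TypeB

end

/-!
Two pictures of a signed permutation are played against each other. Locally, `s_j` corresponds to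
the two pairs `±(j, j + 1)` of consecutive points, and `y s_j y⁻¹ = s_i` for a `y` without descent
at `j` means that `y` maps the pairs of `s_j` to those of `s_i`. Globally, the components of `J` are
the fibres of the label map, and `W_J` is the group of signed permutations preserving labels.

Combining both, a double coset is core exactly if its minimal element is a block permutation. Such a
`y` satisfies `W_I y W_J = y W_J` and `ℓ(y u) = ℓ(y) + ℓ(u)` for `u ∈ W_J`, so reduced compositions
of core cosets are reduced compositions of block permutations. Lengths add in a product of signed
permutations exactly if no inversion is restored. As block permutations are increasing on each
component, only inversions between different components matter, and these are the inversions of the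
squashed permutations. A block permutation with trivial squash preserves labels and is increasing
on components, hence is trivial; this gives injectivity.

For `t ∉ J` and `K = J ∪ {t}` the element `w_K w_J` is the minimal element of an atomic coset. It
lies in `W_K`, so its squash lies in the parabolic subgroup generated by the simple reflection that
merges the two components of `J` joined by `t`; being nontrivial, it is that reflection.
Surjectivity and the statement on reduced expressions follow by composing such cosets along words of
simple reflections.
-/

noncomputable section

namespace TypeB

variable {n k : ℕ} {I J K : Finset (Fin n)}

namespace W

theorem apply_neg (w : W n) (x : Pt n) : w.1 (-x) = -w.1 x := w.2 x

theorem mul_apply (u v : W n) (x : Pt n) : (u * v).1 x = u.1 (v.1 x) := rfl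

theorem inv_apply_self (u : W n) (x : Pt n) : (u⁻¹).1 (u.1 x) = x :=
  u.1.symm_apply_apply x

theorem apply_inv_self (u : W n) (x : Pt n) : u.1 ((u⁻¹).1 x) = x :=
  u.1.apply_symm_apply x

theorem ext {u v : W n} (h : ∀ x, u.1 x = v.1 x) : u = v :=
  Subtype.ext (Equiv.ext h)

end W

theorem Pt.lt_iff {a b : Pt n} : a < b ↔ a.1 < b.1 := Iff.rfl

theorem Pt.neg_lt_neg_iff {a b : Pt n} : -a < -b ↔ b < a :=
  _root_.neg_lt_neg_iff (α := ℤ)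

theorem W.coe_apply_eq_zero_iff (w : W n) {x : Pt n} : (w.1 x).1 = 0 ↔ x.1 = 0 := by
  have fixed_iff (y : Pt n) : y.1 = 0 ↔ -y = y := by
    rw [Subtype.ext_iff, Pt.coe_neg]; omega
  rw [fixed_iff, fixed_iff, ← w.apply_neg, w.1.injective.eq_iff]

theorem coe_pt (i : Fin n) : (pt i).1 = (i : ℤ) := rfl

theorem coe_ptSucc (i : Fin n) : (ptSucc i).1 = (i : ℤ) + 1 := rfl

theorem coe_simple_apply (i : Fin n) (x : Pt n) :
    ((simple i).1 x).1 =
      if x.1 = i + 1 then (if (i : ℕ) = 0 then -1 else (i : ℤ))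
      else if x.1 = -(i + 1) then (if (i : ℕ) = 0 then 1 else -(i : ℤ))
      else if x.1 = i then (if (i : ℕ) = 0 then 0 else (i : ℤ) + 1)
      else if x.1 = -i then -(i + 1) else x.1 := by
  have hx : ∀ a : Pt n, x = a ↔ x.1 = a.1 := fun a => Subtype.ext_iff
  change (simplePerm i x).1 = _
  unfold simplePerm
  by_cases h : (i : ℕ) = 0
  · rw [if_pos h, Equiv.swap_apply_def]
    simp only [hx, Pt.coe_neg, coe_ptSucc, h]
    split_ifs <;> simp_all [Pt.coe_neg, coe_ptSucc]
  · rw [if_neg h, Equiv.Perm.mul_apply, Equiv.swap_apply_def, Equiv.swap_apply_def]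
    simp only [hx, Subtype.ext_iff, Pt.coe_neg, coe_ptSucc, coe_pt]
    split_ifs <;> simp_all [Pt.coe_neg, coe_ptSucc, coe_pt] <;> omega

theorem simple_mul_self (i : Fin n) : simple i * simple i = 1 := by
  refine W.ext fun x => Subtype.ext ?_
  rw [W.mul_apply, coe_simple_apply, coe_simple_apply]
  change _ = x.1
  split_ifs <;> omega

theorem simple_apply_simple_apply (i : Fin n) (x : Pt n) :
    (simple i).1 ((simple i).1 x) = x := by
  rw [← W.mul_apply, simple_mul_self]; rfl

theorem simple_inv (i : Fin n) : (simple i)⁻¹ = simple i :=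
  inv_eq_of_mul_eq_one_left (simple_mul_self i)

theorem mul_simple_mul_simple (w : W n) (i : Fin n) : w * simple i * simple i = w := by
  rw [mul_assoc, simple_mul_self, mul_one]

/-- The pairs `(j, j + 1)` and `(-j - 1, -j)` of consecutive points, which correspond to the simple
reflection `s_j`. Every pair of consecutive points belongs to exactly one `j`. -/
def IsEdge (j : Fin n) (a b : Pt n) : Prop :=
  a = pt j ∧ b = ptSucc j ∨ a = -ptSucc j ∧ b = -pt j

theorem isEdge_pt (j : Fin n) : IsEdge j (pt j) (ptSucc j) := Or.inl ⟨rfl, rfl⟩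

namespace IsEdge

variable {i j : Fin n} {a b : Pt n}

theorem coe_eq (h : IsEdge j a b) : b.1 = a.1 + 1 := by
  obtain ⟨rfl, rfl⟩ | ⟨rfl, rfl⟩ := h
  · rfl
  · rw [Pt.coe_neg, Pt.coe_neg, coe_pt, coe_ptSucc]; omega

theorem lt (h : IsEdge j a b) : a < b := by
  have := h.coe_eq
  rw [Pt.lt_iff]; omega

theorem neg (h : IsEdge j a b) : IsEdge j (-b) (-a) := by
  obtain ⟨rfl, rfl⟩ | ⟨rfl, rfl⟩ := h
  · exact Or.inr ⟨rfl, rfl⟩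
  · exact Or.inl ⟨Pt.neg_neg _, Pt.neg_neg _⟩

theorem labelInt_eq_iff (h : IsEdge j a b) : labelInt J a = labelInt J b ↔ j ∈ J := by
  have key : labelInt J (pt j) = labelInt J (ptSucc j) ↔ j ∈ J := by
    refine ⟨fun h => ?_, labelInt_ptSucc⟩
    rw [labelInt_of_nonneg J (by rw [coe_pt]; omega),
      labelInt_of_nonneg J (by rw [coe_ptSucc]; omega), coe_pt, coe_ptSucc,
      Int.natAbs_natCast, show ((j : ℤ) + 1).natAbs = j + 1 by omega, gaps_succ] at h
    split_ifs at h with hj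
    · exact hj
    · omega
  obtain ⟨rfl, rfl⟩ | ⟨rfl, rfl⟩ := h
  · exact key
  · rw [labelInt_neg, labelInt_neg, neg_inj, eq_comm, key]

theorem mem (h : IsEdge j a b) (hl : labelInt J a = labelInt J b) : j ∈ J :=
  h.labelInt_eq_iff.mp hl

theorem labelInt_eq (h : IsEdge j a b) (hj : j ∈ J) : labelInt J a = labelInt J b :=
  h.labelInt_eq_iff.mpr hj

theorem map {y : W n} (hi : IsEdge i (y.1 (pt j)) (y.1 (ptSucc j))) (h : IsEdge j a b) :
    IsEdge i (y.1 a) (y.1 b) := by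
  obtain ⟨rfl, rfl⟩ | ⟨rfl, rfl⟩ := h
  · exact hi
  · rw [y.apply_neg, y.apply_neg]
    exact hi.neg

theorem inv_map {y : W n} (hi : IsEdge i (y.1 (pt j)) (y.1 (ptSucc j))) :
    IsEdge j ((y⁻¹).1 (pt i)) ((y⁻¹).1 (ptSucc i)) := by
  obtain ⟨h1, h2⟩ | ⟨h1, h2⟩ := hi
  · exact Or.inl ⟨by rw [← h1, y.inv_apply_self], by rw [← h2, y.inv_apply_self]⟩
  · refine Or.inr ⟨?_, ?_⟩
    · rw [← Pt.neg_inj, ← W.apply_neg, ← h2, y.inv_apply_self, Pt.neg_neg]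
    · rw [← Pt.neg_inj, ← W.apply_neg, ← h1, y.inv_apply_self, Pt.neg_neg]

end IsEdge

theorem exists_isEdge {a b : Pt n} (h : b.1 = a.1 + 1) : ∃ j, IsEdge j a b := by
  have ha := abs_le.mp a.2
  have hb := abs_le.mp b.2
  rcases le_or_gt 0 a.1 with h0 | h0
  · refine ⟨⟨a.1.natAbs, by omega⟩, Or.inl ⟨Subtype.ext ?_, Subtype.ext ?_⟩⟩ <;>
      simp only [coe_pt, coe_ptSucc] <;> omega
  · refine ⟨⟨b.1.natAbs, by omega⟩, Or.inr ⟨Subtype.ext ?_, Subtype.ext ?_⟩⟩ <;>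
      simp only [Pt.coe_neg, coe_pt, coe_ptSucc] <;> omega

/-- `w` ascends at `j` if `w` preserves the order of `j` and `j + 1`; otherwise `s_j` is a right
descent of `w`. -/
def IsAscent (w : W n) (j : Fin n) : Prop := w.1 (pt j) < w.1 (ptSucc j)

theorem not_isAscent_iff {w : W n} {j : Fin n} :
    ¬IsAscent w j ↔ w.1 (ptSucc j) < w.1 (pt j) := by
  have := w.1.injective.ne (isEdge_pt j).lt.ne'
  rw [IsAscent, not_lt, le_iff_lt_or_eq, or_iff_left this]

theorem IsEdge.apply_lt_apply_iff {j : Fin n} {a b : Pt n} (h : IsEdge j a b) (w : W n) :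
    w.1 a < w.1 b ↔ IsAscent w j := by
  obtain ⟨rfl, rfl⟩ | ⟨rfl, rfl⟩ := h
  · rfl
  · rw [W.apply_neg, W.apply_neg, Pt.neg_lt_neg_iff, IsAscent]

theorem isAscent_one (j : Fin n) : IsAscent 1 j := (isEdge_pt j).lt

theorem simple_apply_ptSucc_lt (j : Fin n) : (simple j).1 (ptSucc j) < (simple j).1 (pt j) := by
  rw [Pt.lt_iff, coe_simple_apply, coe_simple_apply, coe_pt, coe_ptSucc]
  split_ifs <;> omega

theorem isEdge_or_eq_of_simple_apply_lt {j : Fin n} {a b : Pt n} (hab : a < b)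
    (h : (simple j).1 b < (simple j).1 a) : IsEdge j a b ∨ b = ptSucc j ∧ a = -b ∧ (j : ℕ) = 0 := by
  rw [Pt.lt_iff, coe_simple_apply, coe_simple_apply] at h
  rw [Pt.lt_iff] at hab
  simp only [IsEdge, Subtype.ext_iff, Pt.coe_neg, coe_pt, coe_ptSucc]
  split_ifs at h <;> omega

theorem apply_lt_apply_iff_of_simple_apply_lt {j : Fin n} {a b : Pt n} (hab : a < b)
    (h : (simple j).1 b < (simple j).1 a) (w : W n) : w.1 a < w.1 b ↔ IsAscent w j := by
  obtain h | ⟨rfl, rfl, hj⟩ := isEdge_or_eq_of_simple_apply_lt hab h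
  · exact h.apply_lt_apply_iff w
  · have h0 := w.coe_apply_eq_zero_iff (x := pt j)
    rw [coe_pt] at h0
    rw [IsAscent, W.apply_neg, Pt.lt_iff, Pt.lt_iff, Pt.coe_neg]
    omega

theorem isAscent_mul_simple_iff {w : W n} {j : Fin n} :
    IsAscent (w * simple j) j ↔ ¬IsAscent w j := by
  have h : w.1 ((simple j).1 (ptSucc j)) < w.1 ((simple j).1 (pt j)) ↔ IsAscent w j := by
    refine apply_lt_apply_iff_of_simple_apply_lt (simple_apply_ptSucc_lt j) ?_ w
    rw [simple_apply_simple_apply, simple_apply_simple_apply]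
    exact (isEdge_pt j).lt
  rw [← h]
  exact not_isAscent_iff.not_right

theorem isEdge_of_not_isAscent_simple_mul {u : W n} {i j : Fin n} (h : IsAscent u i)
    (hj : ¬IsAscent (simple j * u) i) : IsEdge j (u.1 (pt i)) (u.1 (ptSucc i)) := by
  obtain h' | ⟨-, h', -⟩ := isEdge_or_eq_of_simple_apply_lt h (not_isAscent_iff.mp hj)
  · exact h'
  · rw [← W.apply_neg, u.1.injective.eq_iff, Subtype.ext_iff, Pt.coe_neg, coe_pt, coe_ptSucc] at h'
    omega

theorem IsEdge.mul_simple_eq {u : W n} {i j : Fin n}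
    (h : IsEdge j (u.1 (pt i)) (u.1 (ptSucc i))) : u * simple i = simple j * u := by
  rw [← mul_inv_eq_iff_eq_mul]
  refine Subtype.ext ?_
  change u.1 * simplePerm i * (u.1)⁻¹ = simplePerm j
  have hi := u.coe_apply_eq_zero_iff (x := pt i)
  have hi' := u.coe_apply_eq_zero_iff (x := ptSucc i)
  obtain ⟨h1, h2⟩ | ⟨h1, h2⟩ := h
  · rw [h1, coe_pt, coe_pt] at hi
    unfold simplePerm
    rw [← h1, ← h2, ← W.apply_neg, ← W.apply_neg]
    by_cases h0 : (i : ℕ) = 0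
    · rw [if_pos h0, if_pos (by omega), Equiv.swap_apply_apply]
    · rw [if_neg h0, if_neg (by omega), Equiv.swap_apply_apply, Equiv.swap_apply_apply]
      group
  · rw [h1, Pt.coe_neg, coe_pt, coe_ptSucc] at hi
    rw [h2, Pt.coe_neg, coe_pt, coe_ptSucc] at hi'
    have e1 : pt j = u.1 (-ptSucc i) := by rw [W.apply_neg, h2, Pt.neg_neg]
    have e2 : ptSucc j = u.1 (-pt i) := by rw [W.apply_neg, h1, Pt.neg_neg]
    have hinv : simplePerm j = (simplePerm j)⁻¹ := congrArg Subtype.val (simple_inv j).symm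
    rw [hinv]
    unfold simplePerm
    rw [if_neg (by omega), if_neg (by omega), mul_inv_rev, Equiv.swap_inv, Equiv.swap_inv, e1, e2,
      ← W.apply_neg, ← W.apply_neg, Pt.neg_neg, Pt.neg_neg, Equiv.swap_comm (u.1 (ptSucc i)),
      Equiv.swap_comm (u.1 (-ptSucc i)), Equiv.swap_apply_apply, Equiv.swap_apply_apply]
    group

theorem mul_simple_eq_iff_isEdge {u : W n} {i j : Fin n} (h : IsAscent u i) :
    u * simple i = simple j * u ↔ IsEdge j (u.1 (pt i)) (u.1 (ptSucc i)) := by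
  refine ⟨fun he => isEdge_of_not_isAscent_simple_mul h ?_, IsEdge.mul_simple_eq⟩
  rwa [← he, isAscent_mul_simple_iff, not_not]

theorem lt_of_labelInt_lt {x y : Pt n} (h : labelInt J x < labelInt J y) : x < y :=
  lt_of_not_ge fun hyx => h.not_ge (labelInt_mono J hyx)

theorem rel_of_forall_isEdge {r : Pt n → Pt n → Prop} [IsTrans (Pt n) r]
    (h : ∀ j ∈ J, ∀ a b, IsEdge j a b → r a b) {x y : Pt n} (hxy : x < y)
    (hl : labelInt J x = labelInt J y) : r x y := by
  obtain ⟨d, hd⟩ : ∃ d : ℕ, x.1 + 1 + d = y.1 := Int.le.dest (Pt.lt_iff.mp hxy)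
  induction d generalizing x with
  | zero =>
    obtain ⟨j, hj⟩ := exists_isEdge (a := x) (b := y) (by omega)
    exact h j (hj.labelInt_eq_iff.mp hl) _ _ hj
  | succ d ih =>
    have hx := abs_le.mp x.2
    have hy := abs_le.mp y.2
    let z : Pt n := ⟨x.1 + 1, abs_le.mpr (by omega)⟩
    have hxz : x < z := Pt.lt_iff.mpr (by change x.1 < x.1 + 1; omega)
    have hzy : z < y := Pt.lt_iff.mpr (by change x.1 + 1 < y.1; omega)
    have hlxz : labelInt J x = labelInt J z :=
      (labelInt_mono J hxz.le).antisymm (hl ▸ labelInt_mono J hzy.le)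
    obtain ⟨j, hj⟩ := exists_isEdge (a := x) (b := z) rfl
    exact _root_.trans (h j (hj.labelInt_eq_iff.mp hlxz) _ _ hj)
      (ih hzy (hlxz ▸ hl) (by change x.1 + 1 + 1 + d = y.1; omega))

theorem apply_lt_apply_of_isAscent {w : W n} (h : ∀ j ∈ J, IsAscent w j) {x y : Pt n}
    (hxy : x < y) (hl : labelInt J x = labelInt J y) : w.1 x < w.1 y := by
  have : IsTrans (Pt n) fun a b => w.1 a < w.1 b := ⟨fun _ _ _ => lt_trans⟩
  exact rel_of_forall_isEdge (r := fun a b => w.1 a < w.1 b)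
    (fun j hj a b hab => (hab.apply_lt_apply_iff w).mpr (h j hj)) hxy hl

theorem apply_lt_apply_of_not_isAscent {w : W n} (h : ∀ j ∈ J, ¬IsAscent w j) {x y : Pt n}
    (hxy : x < y) (hl : labelInt J x = labelInt J y) : w.1 y < w.1 x := by
  have : IsTrans (Pt n) fun a b => w.1 b < w.1 a := ⟨fun _ _ _ h1 h2 => h2.trans h1⟩
  refine rel_of_forall_isEdge (r := fun a b => w.1 b < w.1 a) (fun j hj a b hab => ?_) hxy hl
  exact lt_of_le_of_ne (not_lt.mp ((hab.apply_lt_apply_iff w).not.mpr (h j hj)))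
    (w.1.injective.ne hab.lt.ne')

theorem eq_of_labelInt_eq {α : Type*} {f : Pt n → α}
    (h : ∀ j ∈ J, ∀ a b, IsEdge j a b → f a = f b) {x y : Pt n}
    (hl : labelInt J x = labelInt J y) : f x = f y := by
  have : IsTrans (Pt n) fun a b => f a = f b := ⟨fun _ _ _ => Eq.trans⟩
  obtain hxy | rfl | hxy := lt_trichotomy x y
  · exact rel_of_forall_isEdge (r := fun a b => f a = f b) h hxy hl
  · rfl
  · exact (rel_of_forall_isEdge (r := fun a b => f a = f b) h hxy hl.symm).symm

theorem eq_one_of_strictMono {w : W n} (h : StrictMono w.1) : w = 1 :=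
  W.ext fun x => congrArg (fun f : Pt n ≃o Pt n => f x) <|
    Subsingleton.elim (h.orderIsoOfSurjective w.1 w.1.surjective) (OrderIso.refl _)

theorem labelInt_univ (x : Pt n) : labelInt Finset.univ x = 0 := by
  simp [labelInt, gaps]

theorem eq_one_of_labelInt_apply_eq {w : W n} (hw : ∀ x, labelInt I (w.1 x) = labelInt J x)
    (h : ∀ j ∈ J, IsAscent w j) : w = 1 :=
  eq_one_of_strictMono fun x y hxy => by
    obtain hl | hl := (labelInt_mono J hxy.le).eq_or_lt
    · exact apply_lt_apply_of_isAscent h hxy hl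
    · exact lt_of_labelInt_lt (J := I) (by rwa [hw, hw])

theorem eq_one_of_forall_isAscent {w : W n} (h : ∀ j, IsAscent w j) : w = 1 :=
  eq_one_of_labelInt_apply_eq (I := Finset.univ) (J := Finset.univ)
    (fun x => by rw [labelInt_univ, labelInt_univ]) fun j _ => h j

theorem labelInt_simple_apply {j : Fin n} (hj : j ∈ J) (x : Pt n) :
    labelInt J ((simple j).1 x) = labelInt J x := by
  have key {a b : Pt n} (hab : a < b) (ha : (simple j).1 a = b) (hb : (simple j).1 b = a) :
      labelInt J a = labelInt J b := by
    obtain h | ⟨rfl, rfl, h0⟩ := isEdge_or_eq_of_simple_apply_lt hab (by rwa [ha, hb])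
    · exact h.labelInt_eq_iff.mpr hj
    · have : labelInt J (pt j) = 0 := by simp [labelInt, coe_pt, h0]
      rw [labelInt_neg, ← labelInt_ptSucc hj, this, neg_zero]
  have hss := simple_apply_simple_apply j x
  obtain hlt | heq | hlt := lt_trichotomy ((simple j).1 x) x
  · exact key hlt hss rfl
  · rw [heq]
  · exact (key hlt rfl hss).symm

theorem simple_mem_parabolic {j : Fin n} (hj : j ∈ J) : simple j ∈ parabolic J :=
  Subgroup.subset_closure ⟨j, hj, rfl⟩

theorem toLex_mul_simple_lt {w : W n} {j : Fin n} (h : ¬IsAscent w j) :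
    toLex (w * simple j).1.toFun < toLex w.1.toFun := by
  refine ⟨-ptSucc j, fun x hx => ?_, ?_⟩
  · have : (simple j).1 x = x := by
      replace hx : x.1 < -(j + 1) := hx
      refine Subtype.ext ?_
      rw [coe_simple_apply]
      split_ifs <;> omega
    exact congrArg w.1 this
  · have hss := simple_apply_simple_apply j (-ptSucc j)
    have hlt : -ptSucc j < (simple j).1 (-ptSucc j) := by
      rw [Pt.lt_iff, coe_simple_apply, Pt.coe_neg, coe_ptSucc]
      split_ifs <;> omega
    have hflip := apply_lt_apply_iff_of_simple_apply_lt hlt (hss.trans_lt hlt) w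
    exact lt_of_le_of_ne (not_lt.mp (hflip.not.mpr h)) (w.1.injective.ne hlt.ne')

/-- The lexicographically smallest element of `w W_J` has no descent in `J`. -/
theorem exists_mem_parabolic_isAscent (J : Finset (Fin n)) (w : W n) :
    ∃ u ∈ parabolic J, ∀ j ∈ J, IsAscent (w * u) j := by
  obtain ⟨u, hu, hmin⟩ := Set.exists_min_image (parabolic J : Set (W n))
    (fun u => toLex (w * u).1.toFun) (Set.toFinite _) ⟨1, one_mem _⟩
  refine ⟨u, hu, fun j hj => ?_⟩
  by_contra hasc
  refine (hmin (u * simple j) (mul_mem hu (simple_mem_parabolic hj))).not_gt ?_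
  rw [← mul_assoc]
  exact toLex_mul_simple_lt hasc

theorem labelInt_apply_of_mem_parabolic {u : W n} (hu : u ∈ parabolic J) (x : Pt n) :
    labelInt J (u.1 x) = labelInt J x := by
  induction hu using Subgroup.closure_induction generalizing x with
  | mem w h => obtain ⟨j, hj, rfl⟩ := h; exact labelInt_simple_apply hj x
  | one => rfl
  | mul u v _ _ hu hv => rw [W.mul_apply, hu, hv]
  | inv u _ hu => rw [← hu, W.apply_inv_self]

theorem eq_and_mem_parabolic_of_labelInt_apply_eq {w : W n}
    (hw : ∀ x, labelInt I (w.1 x) = labelInt J x) : I = J ∧ w ∈ parabolic J := by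
  obtain ⟨u, hu, hasc⟩ := exists_mem_parabolic_isAscent J w
  have hwu' (x : Pt n) : labelInt I ((w * u).1 x) = labelInt J x := by
    rw [W.mul_apply, hw, labelInt_apply_of_mem_parabolic hu]
  have hwu : w * u = 1 := eq_one_of_labelInt_apply_eq hwu' hasc
  refine ⟨Finset.ext fun j => ?_, eq_inv_of_mul_eq_one_left hwu ▸ inv_mem hu⟩
  rw [hwu] at hwu'
  rw [← (isEdge_pt j).labelInt_eq_iff, ← (isEdge_pt j).labelInt_eq_iff, ← hwu', ← hwu']
  rfl

theorem mem_parabolic_iff {w : W n} :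
    w ∈ parabolic J ↔ ∀ x, labelInt J (w.1 x) = labelInt J x :=
  ⟨labelInt_apply_of_mem_parabolic, fun hw => (eq_and_mem_parabolic_of_labelInt_apply_eq hw).2⟩

theorem parabolic_univ : parabolic (Finset.univ : Finset (Fin n)) = ⊤ :=
  Subgroup.ext fun w => iff_of_true
    (mem_parabolic_iff.mpr fun x => by rw [labelInt_univ, labelInt_univ]) trivial

theorem exists_word (w : W n) : ∃ ω : List (Fin n), (ω.map simple).prod = w := by
  have hw : w ∈ parabolic Finset.univ := parabolic_univ (n := n) ▸ Subgroup.mem_top w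
  induction hw using Subgroup.closure_induction with
  | mem w h => obtain ⟨j, -, rfl⟩ := h; exact ⟨[j], List.prod_singleton⟩
  | one => exact ⟨[], rfl⟩
  | mul u v _ _ hu hv =>
    obtain ⟨⟨ω, rfl⟩, ω', rfl⟩ := And.intro hu hv
    exact ⟨ω ++ ω', by rw [List.map_append, List.prod_append]⟩
  | inv u _ hu =>
    obtain ⟨ω, rfl⟩ := hu
    refine ⟨ω.reverse, ?_⟩
    rw [List.prod_inv_reverse, List.map_reverse, List.map_map]
    congr 3
    exact funext fun j => (simple_inv j).symm

theorem len_prod_le (ω : List (Fin n)) : len (ω.map simple).prod ≤ ω.length :=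
  Nat.sInf_le ⟨ω, rfl, rfl⟩

theorem exists_isReducedWord (w : W n) : ∃ ω, IsReducedWord w ω := by
  obtain ⟨ω, hω⟩ := exists_word w
  obtain ⟨ω', hlen, hprod⟩ := Nat.sInf_mem
    (s := {d | ∃ ω : List (Fin n), ω.length = d ∧ (ω.map simple).prod = w}) ⟨_, ω, rfl, hω⟩
  exact ⟨ω', hprod, hlen⟩

/-- The exchange condition. Going through the word from the right, the descent at `i` is created at
some letter `s_j` by an element `u` that ascends at `i`; there `s_j u = u s_i`. -/
theorem exists_word_mul_simple {ω : List (Fin n)} {i : Fin n}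
    (h : ¬IsAscent (ω.map simple).prod i) :
    ∃ ω' : List (Fin n), ω'.length + 1 = ω.length ∧
      (ω'.map simple).prod = (ω.map simple).prod * simple i := by
  induction ω with
  | nil => exact absurd (isAscent_one i) h
  | cons j ω ih =>
    rw [List.map_cons, List.prod_cons] at h
    by_cases hasc : IsAscent (ω.map simple).prod i
    · refine ⟨ω, rfl, ?_⟩
      rw [List.map_cons, List.prod_cons, mul_assoc,
        (isEdge_of_not_isAscent_simple_mul hasc h).mul_simple_eq, ← mul_assoc, simple_mul_self,
        one_mul]
    · obtain ⟨ω', hlen, hprod⟩ := ih hasc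
      refine ⟨j :: ω', by rw [List.length_cons, List.length_cons, hlen], ?_⟩
      rw [List.map_cons, List.map_cons, List.prod_cons, List.prod_cons, hprod, mul_assoc]

theorem len_one : len (1 : W n) = 0 :=
  Nat.le_zero.mp (len_prod_le [])

theorem eq_one_of_len_eq_zero {w : W n} (h : len w = 0) : w = 1 := by
  obtain ⟨ω, hprod, hlen⟩ := exists_isReducedWord w
  rw [h, List.length_eq_zero_iff] at hlen
  rw [← hprod, hlen]
  rfl

theorem len_mul_le (u v : W n) : len (u * v) ≤ len u + len v := by
  obtain ⟨ω, rfl, hω⟩ := exists_isReducedWord u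
  obtain ⟨ω', rfl, hω'⟩ := exists_isReducedWord v
  rw [← hω, ← hω', ← List.length_append, ← List.prod_append, ← List.map_append]
  exact len_prod_le _

theorem len_simple_le (i : Fin n) : len (simple i) ≤ 1 := by
  simpa using len_prod_le [i]

theorem len_mul_simple_of_not_isAscent {w : W n} {i : Fin n} (h : ¬IsAscent w i) :
    len (w * simple i) + 1 = len w := by
  obtain ⟨ω, rfl, hω⟩ := exists_isReducedWord w
  obtain ⟨ω', hlen, hprod⟩ := exists_word_mul_simple h
  have h1 := len_prod_le ω'
  have h2 := len_mul_le ((ω.map simple).prod * simple i) (simple i)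
  have h3 := len_simple_le i
  rw [mul_simple_mul_simple] at h2
  rw [hprod] at h1
  omega

theorem len_mul_simple_of_isAscent {w : W n} {i : Fin n} (h : IsAscent w i) :
    len (w * simple i) = len w + 1 := by
  have := len_mul_simple_of_not_isAscent (isAscent_mul_simple_iff.not_left.mpr h)
  rwa [mul_simple_mul_simple, eq_comm] at this

theorem len_simple (i : Fin n) : len (simple i) = 1 := by
  simpa [len_one] using len_mul_simple_of_isAscent (isAscent_one i)

theorem exists_not_isAscent {w : W n} (h : w ≠ 1) : ∃ i, ¬IsAscent w i := by
  by_contra! hasc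
  exact h (eq_one_of_forall_isAscent hasc)

theorem forall_apply_lt_mul_simple_iff {u v : W n} {i : Fin n} (h : IsAscent v i) :
    (∀ a b, a < b → (v * simple i).1 b < (v * simple i).1 a →
      u.1 ((v * simple i).1 b) < u.1 ((v * simple i).1 a)) ↔
    (∀ a b, a < b → v.1 b < v.1 a → u.1 (v.1 b) < u.1 (v.1 a)) ∧ IsAscent (u * v) i := by
  constructor
  · refine fun huv => ⟨fun a b hab hba => ?_, ?_⟩
    · have hlt : (simple i).1 a < (simple i).1 b := by
        by_contra hn
        refine hba.not_gt ((apply_lt_apply_iff_of_simple_apply_lt hab ?_ v).mpr h)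
        exact lt_of_le_of_ne (not_lt.mp hn) ((simple i).1.injective.ne hab.ne')
      have := huv _ _ hlt
      simp only [W.mul_apply, simple_apply_simple_apply] at this
      exact this hba
    · have hv := not_isAscent_iff.mp (isAscent_mul_simple_iff.not_left.mpr h)
      refine isAscent_mul_simple_iff.not_left.mp (not_isAscent_iff.mpr ?_)
      exact huv _ _ (isEdge_pt i).lt hv
  · rintro ⟨huv, hasc⟩ a b hab hba
    by_cases hlt : (simple i).1 a < (simple i).1 b
    · exact huv _ _ hlt hba
    · have hflip := apply_lt_apply_iff_of_simple_apply_lt hab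
        (lt_of_le_of_ne (not_lt.mp hlt) ((simple i).1.injective.ne hab.ne')) (u * (v * simple i))
      rw [← mul_assoc, isAscent_mul_simple_iff] at hflip
      exact lt_of_le_of_ne (not_lt.mp (hflip.not.mpr (not_not.mpr hasc)))
        ((u * v * simple i).1.injective.ne hab.ne')

theorem len_mul_eq_iff {u v : W n} :
    len (u * v) = len u + len v ↔ ∀ a b, a < b → v.1 b < v.1 a → u.1 (v.1 b) < u.1 (v.1 a) := by
  induction hd : len v generalizing v with
  | zero =>
    obtain rfl := eq_one_of_len_eq_zero hd
    exact iff_of_true (by rw [mul_one, add_zero]) fun a b hab hba => absurd hba hab.not_gt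
  | succ d ih =>
    obtain ⟨i, hi⟩ := exists_not_isAscent (w := v) (by rintro rfl; rw [len_one] at hd; omega)
    have hlen := len_mul_simple_of_not_isAscent hi
    have hasc : IsAscent (v * simple i) i := isAscent_mul_simple_iff.mpr hi
    have hv : v = v * simple i * simple i := (mul_simple_mul_simple v i).symm
    generalize v * simple i = v' at *
    subst hv
    rw [forall_apply_lt_mul_simple_iff hasc, ← ih (by omega), ← mul_assoc]
    have hle := len_mul_le u v'
    by_cases huv : IsAscent (u * v') i
    · have := len_mul_simple_of_isAscent huv
      grind
    · have := len_mul_simple_of_not_isAscent huv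
      grind

theorem maxElt_spec {A : Set (W n)} (h : A.Nonempty) :
    maxElt A ∈ A ∧ ∀ z ∈ A, len z ≤ len (maxElt A) := by
  unfold maxElt
  rw [dif_pos h]
  exact (Set.exists_max_image A len A.toFinite h).choose_spec

theorem minElt_spec {A : Set (W n)} (h : A.Nonempty) :
    minElt A ∈ A ∧ ∀ z ∈ A, len (minElt A) ≤ len z := by
  unfold minElt
  rw [dif_pos h]
  exact (Set.exists_min_image A len A.toFinite h).choose_spec

theorem not_isAscent_of_forall_len_le {u : W n} (hu : u ∈ parabolic J)
    (h : ∀ z ∈ parabolic J, len z ≤ len u) {j : Fin n} (hj : j ∈ J) : ¬IsAscent u j := by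
  intro hasc
  have h1 := len_mul_simple_of_isAscent hasc
  have h2 := h _ (mul_mem hu (simple_mem_parabolic hj))
  omega

theorem eq_of_forall_not_isAscent {u v : W n} (hu : u ∈ parabolic J) (hv : v ∈ parabolic J)
    (hu' : ∀ j ∈ J, ¬IsAscent u j) (hv' : ∀ j ∈ J, ¬IsAscent v j) : u = v := by
  have hmem := mem_parabolic_iff.mp (mul_mem (inv_mem hu) hv)
  refine inv_mul_eq_one.mp (eq_one_of_labelInt_apply_eq hmem fun j hj => ?_)
  by_contra hasc
  have hlt := apply_lt_apply_of_not_isAscent hu' (not_isAscent_iff.mp hasc)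
    (by rw [hmem, hmem, labelInt_ptSucc hj])
  rw [W.mul_apply, W.mul_apply, W.apply_inv_self, W.apply_inv_self] at hlt
  exact hv' j hj hlt

theorem longest_mem (J : Finset (Fin n)) : longest J ∈ parabolic J :=
  (maxElt_spec (A := (parabolic J : Set (W n))) ⟨1, one_mem _⟩).1

theorem len_le_len_longest {z : W n} (hz : z ∈ parabolic J) : len z ≤ len (longest J) :=
  (maxElt_spec (A := (parabolic J : Set (W n))) ⟨1, one_mem _⟩).2 z hz

theorem labelInt_longest_apply (J : Finset (Fin n)) (x : Pt n) :
    labelInt J ((longest J).1 x) = labelInt J x :=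
  mem_parabolic_iff.mp (longest_mem J) x

theorem isAscent_longest_iff {j : Fin n} : IsAscent (longest J) j ↔ j ∉ J := by
  constructor
  · exact fun h hj =>
      not_isAscent_of_forall_len_le (longest_mem J) (fun _ => len_le_len_longest) hj h
  · refine fun hj => lt_of_labelInt_lt (J := J) ?_
    rw [labelInt_longest_apply, labelInt_longest_apply]
    exact lt_of_le_of_ne (labelInt_mono J (isEdge_pt j).lt.le) fun h => hj ((isEdge_pt j).mem h)

theorem eq_longest {u : W n} (hu : u ∈ parabolic J) (h : ∀ j ∈ J, ¬IsAscent u j) :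
    u = longest J :=
  eq_of_forall_not_isAscent hu (longest_mem J) h fun _ hj =>
    isAscent_longest_iff.not_left.mpr hj

theorem longest_apply_lt {x y : Pt n} (hxy : x < y) (hl : labelInt J x = labelInt J y) :
    (longest J).1 y < (longest J).1 x :=
  apply_lt_apply_of_not_isAscent (fun _ hj => isAscent_longest_iff.not_left.mpr hj) hxy hl

theorem longest_mul_self (J : Finset (Fin n)) : longest J * longest J = 1 := by
  refine eq_one_of_labelInt_apply_eq (J := J)
    (fun x => by rw [W.mul_apply, labelInt_longest_apply, labelInt_longest_apply]) fun j hj => ?_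
  exact longest_apply_lt (longest_apply_lt (isEdge_pt j).lt (labelInt_ptSucc hj))
    (by rw [labelInt_longest_apply, labelInt_longest_apply, labelInt_ptSucc hj])

theorem longest_inv (J : Finset (Fin n)) : (longest J)⁻¹ = longest J :=
  inv_eq_of_mul_eq_one_left (longest_mul_self J)

theorem longest_injective : Function.Injective (longest (n := n)) := by
  intro I J h
  ext j
  rw [← not_iff_not, ← isAscent_longest_iff, ← isAscent_longest_iff, h]

theorem card_pt (k : ℕ) : Nat.card (Pt k) = 2 * k + 1 := by
  have e : Pt k ≃ Finset.Icc (-(k : ℤ)) k :=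
    Equiv.subtypeEquivRight fun x => by rw [Finset.mem_Icc, abs_le]
  rw [Nat.card_congr e, Nat.card_eq_fintype_card, Fintype.card_coe, Int.card_Icc]
  omega

theorem isBlock_iff_labelInt {y : W n} :
    IsBlock I J y ↔
      (∀ a b, labelInt J a = labelInt J b ↔ labelInt I (y.1 a) = labelInt I (y.1 b)) ∧
      ∀ a b, a < b → labelInt J a = labelInt J b → y.1 a < y.1 b := by
  simp only [labelInt_eq_iff]
  constructor
  · exact fun h => ⟨h.compSetoid_iff, fun a b hab hl =>
      h.strictMonoOn b hl ((compSetoid J).refl b) hab⟩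
  · rintro ⟨hiff, hlt⟩
    refine ⟨fun x => Set.ext fun z => ⟨?_, fun hz => ?_⟩, fun x a ha b hb hab => ?_⟩
    · rintro ⟨c, hc, rfl⟩
      exact (hiff c x).mp hc
    · refine ⟨(y⁻¹).1 z, (hiff _ x).mpr ?_, W.apply_inv_self y z⟩
      rw [W.apply_inv_self]; exact hz
    · exact hlt a b hab ((compSetoid J).trans ha ((compSetoid J).symm hb))

namespace IsBlock

variable {y z : W n}

theorem labelInt_eq_iff (h : IsBlock I J y) (a b : Pt n) :
    labelInt J a = labelInt J b ↔ labelInt I (y.1 a) = labelInt I (y.1 b) :=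
  (isBlock_iff_labelInt.mp h).1 a b

theorem apply_lt_apply (h : IsBlock I J y) {a b : Pt n} (hab : a < b)
    (hl : labelInt J a = labelInt J b) : y.1 a < y.1 b :=
  (isBlock_iff_labelInt.mp h).2 a b hab hl

theorem isAscent (h : IsBlock I J y) {j : Fin n} (hj : j ∈ J) : IsAscent y j :=
  h.apply_lt_apply (isEdge_pt j).lt (labelInt_ptSucc hj)

theorem one (J : Finset (Fin n)) : IsBlock J J (1 : W n) :=
  isBlock_iff_labelInt.mpr ⟨fun _ _ => Iff.rfl, fun _ _ h _ => h⟩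

theorem mul (h : IsBlock I J y) (h' : IsBlock J K z) : IsBlock I K (y * z) := by
  refine isBlock_iff_labelInt.mpr ⟨fun a b => ?_, fun a b hab hl => ?_⟩
  · rw [h'.labelInt_eq_iff, h.labelInt_eq_iff]; rfl
  · exact h.apply_lt_apply (h'.apply_lt_apply hab hl) ((h'.labelInt_eq_iff a b).mp hl)

theorem inv (h : IsBlock I J y) : IsBlock J I y⁻¹ := by
  refine isBlock_iff_labelInt.mpr ⟨fun a b => ?_, fun a b hab hl => ?_⟩
  · rw [h.labelInt_eq_iff, W.apply_inv_self, W.apply_inv_self]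
  · by_contra hn
    have hlt := h.apply_lt_apply
      (lt_of_le_of_ne (not_lt.mp hn) ((y⁻¹).1.injective.ne hab.ne'))
      (by rw [h.labelInt_eq_iff, W.apply_inv_self, W.apply_inv_self, hl])
    rw [W.apply_inv_self, W.apply_inv_self] at hlt
    exact hab.not_gt hlt

/-- A point strictly between the images of two consecutive points of a component of `J` would have a
preimage strictly between them. -/
theorem exists_isEdge (h : IsBlock I J y) {j : Fin n} (hj : j ∈ J) :
    ∃ i ∈ I, IsEdge i (y.1 (pt j)) (y.1 (ptSucc j)) := by
  have hl := (h.labelInt_eq_iff _ _).mp (labelInt_ptSucc hj)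
  have hlt : y.1 (pt j) < y.1 (ptSucc j) := h.isAscent hj
  have hcov : (y.1 (ptSucc j)).1 = (y.1 (pt j)).1 + 1 := by
    by_contra hne
    have ha := abs_le.mp (y.1 (pt j)).2
    have hb := abs_le.mp (y.1 (ptSucc j)).2
    rw [Pt.lt_iff] at hlt
    let c : Pt n := ⟨(y.1 (pt j)).1 + 1, abs_le.mpr (by omega)⟩
    have hac : y.1 (pt j) < c := Pt.lt_iff.mpr (lt_add_one _)
    have hcb : c < y.1 (ptSucc j) := Pt.lt_iff.mpr (by change (y.1 (pt j)).1 + 1 < _; omega)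
    have hlc : labelInt I (y.1 (pt j)) = labelInt I c :=
      (labelInt_mono I hac.le).antisymm (hl ▸ labelInt_mono I hcb.le)
    have h1 := h.inv.apply_lt_apply hac hlc
    have h2 := h.inv.apply_lt_apply hcb (hlc ▸ hl)
    rw [W.inv_apply_self, Pt.lt_iff, coe_pt] at h1
    rw [W.inv_apply_self, Pt.lt_iff, coe_ptSucc] at h2
    omega
  obtain ⟨i, hi⟩ := TypeB.exists_isEdge hcov
  exact ⟨i, hi.mem hl, hi⟩

end IsBlock

theorem isBlock_iff_isEdge {y : W n} :
    IsBlock I J y ↔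
      (∀ i ∈ I, ∃ j ∈ J, IsEdge i (y.1 (pt j)) (y.1 (ptSucc j))) ∧
      ∀ j ∈ J, ∃ i ∈ I, IsEdge i (y.1 (pt j)) (y.1 (ptSucc j)) := by
  constructor
  · refine fun h => ⟨fun i hi => ?_, fun j => h.exists_isEdge⟩
    obtain ⟨j, hj, hij⟩ := h.inv.exists_isEdge hi
    exact ⟨j, hj, by simpa only [inv_inv] using hij.inv_map⟩
  · rintro ⟨hI, hJ⟩
    refine isBlock_iff_labelInt.mpr ⟨fun a b => ⟨fun hl => ?_, fun hl => ?_⟩, fun a b => ?_⟩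
    · refine eq_of_labelInt_eq (f := fun x => labelInt I (y.1 x)) (fun j hj c d hcd => ?_) hl
      obtain ⟨i, hi, hij⟩ := hJ j hj
      exact (hij.map hcd).labelInt_eq hi
    · have := eq_of_labelInt_eq (f := fun x => labelInt J ((y⁻¹).1 x)) (fun i hi c d hcd => ?_) hl
      · simpa only [W.inv_apply_self] using this
      · obtain ⟨j, hj, hij⟩ := hI i hi
        exact (hij.inv_map.map hcd).labelInt_eq hj
    · refine apply_lt_apply_of_isAscent fun j hj => ?_
      obtain ⟨i, -, hij⟩ := hJ j hj
      exact hij.lt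

namespace IsBlock

variable {y z : W n}

theorem conj_mem_parabolic (h : IsBlock I J y) {u : W n} (hu : u ∈ parabolic J) :
    y * u * y⁻¹ ∈ parabolic I := by
  refine mem_parabolic_iff.mpr fun x => ?_
  have hl := (h.labelInt_eq_iff _ _).mp (labelInt_apply_of_mem_parabolic hu ((y⁻¹).1 x))
  rwa [W.apply_inv_self] at hl

theorem len_mul (h : IsBlock I J y) {u : W n} (hu : u ∈ parabolic J) :
    len (y * u) = len y + len u := by
  refine len_mul_eq_iff.mpr fun a b hab hlt => h.apply_lt_apply hlt ?_
  refine (labelInt_mono J hlt.le).antisymm ?_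
  rw [labelInt_apply_of_mem_parabolic hu, labelInt_apply_of_mem_parabolic hu]
  exact labelInt_mono J hab.le

theorem mul_longest (h : IsBlock I J y) : y * longest J = longest I * y := by
  refine mul_inv_eq_iff_eq_mul.mp (eq_longest (h.conj_mem_parabolic (longest_mem J)) fun i hi => ?_)
  have hl := (h.inv.labelInt_eq_iff _ _).mp (labelInt_ptSucc hi)
  have hlt := longest_apply_lt (h.inv.isAscent hi) hl
  refine not_isAscent_iff.mpr (h.apply_lt_apply hlt ?_)
  rw [labelInt_longest_apply, labelInt_longest_apply, hl]

theorem card_eq (h : IsBlock I J y) : I.card = J.card := by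
  have hI : I.card + (n - I.card) = n := Nat.add_sub_cancel' (card_finset_fin_le I)
  have hJ : J.card + (n - J.card) = n := Nat.add_sub_cancel' (card_finset_fin_le J)
  have e := Nat.card_congr ((labelEquiv J hJ).symm.trans
    ((Quotient.congr y.1 h.compSetoid_iff).trans (labelEquiv I hI)))
  rw [card_pt, card_pt] at e
  omega

theorem mem_cosetOf_iff (h : IsBlock I J y) {z : W n} :
    z ∈ (cosetOf I J y).carrier ↔ ∃ u ∈ parabolic J, z = y * u := by
  change z ∈ DoubleCoset.doubleCoset y _ _ ↔ _
  rw [DoubleCoset.mem_doubleCoset]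
  constructor
  · rintro ⟨a, ha, b, hb, rfl⟩
    have := h.inv.conj_mem_parabolic ha
    rw [inv_inv] at this
    exact ⟨y⁻¹ * a * y * b, mul_mem this hb, by group⟩
  · rintro ⟨u, hu, rfl⟩
    exact ⟨1, one_mem _, u, hu, by group⟩

end IsBlock

namespace Coset

theorem carrier_nonempty (p : Coset I J) : p.carrier.Nonempty := by
  obtain ⟨w, hw⟩ := p.isDoubleCoset
  exact ⟨w, hw ▸ DoubleCoset.mem_doubleCoset_self _ _ w⟩

theorem eq_cosetOf_of_mem {p : Coset I J} {z : W n} (hz : z ∈ p.carrier) : p = cosetOf I J z := by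
  obtain ⟨w, hw⟩ := p.isDoubleCoset
  rw [hw] at hz
  exact Coset.ext (hw.trans (DoubleCoset.doubleCoset_eq_of_mem hz).symm)

theorem min_mem (p : Coset I J) : p.min ∈ p.carrier :=
  (minElt_spec p.carrier_nonempty).1

theorem len_min_le {p : Coset I J} {z : W n} (hz : z ∈ p.carrier) : len p.min ≤ len z :=
  (minElt_spec p.carrier_nonempty).2 z hz

theorem max_mem (p : Coset I J) : p.max ∈ p.carrier :=
  (maxElt_spec p.carrier_nonempty).1

theorem len_le_len_max {p : Coset I J} {z : W n} (hz : z ∈ p.carrier) : len z ≤ len p.max :=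
  (maxElt_spec p.carrier_nonempty).2 z hz

theorem eq_cosetOf_min (p : Coset I J) : p = cosetOf I J p.min :=
  eq_cosetOf_of_mem p.min_mem

theorem mul_mem_carrier {p : Coset I J} {z u : W n} (hz : z ∈ p.carrier) (hu : u ∈ parabolic J) :
    z * u ∈ p.carrier := by
  rw [eq_cosetOf_of_mem hz]
  exact DoubleCoset.mem_doubleCoset.mpr ⟨1, one_mem _, u, hu, by rw [one_mul]⟩

theorem isAscent_min (p : Coset I J) {j : Fin n} (hj : j ∈ J) : IsAscent p.min j := by
  by_contra hasc
  have h1 := len_mul_simple_of_not_isAscent hasc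
  have h2 := len_min_le (mul_mem_carrier p.min_mem (simple_mem_parabolic hj))
  omega

/-- `s_i = p_min s_j p_min⁻¹` means that `p_min` moves the edges of `s_j` onto those of `s_i`. -/
theorem isCore_iff {p : Coset I J} : p.IsCore ↔ IsBlock I J p.min := by
  have hconj {i j : Fin n} (hj : j ∈ J) : simple i = p.min * simple j * p.min⁻¹ ↔
      IsEdge i (p.min.1 (pt j)) (p.min.1 (ptSucc j)) := by
    rw [eq_mul_inv_iff_mul_eq, eq_comm, mul_simple_eq_iff_isEdge (p.isAscent_min hj)]
  have hconj' {i j : Fin n} (hj : j ∈ J) : simple j = p.min⁻¹ * simple i * p.min ↔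
      IsEdge i (p.min.1 (pt j)) (p.min.1 (ptSucc j)) := by
    rw [mul_assoc, eq_inv_mul_iff_mul_eq, mul_simple_eq_iff_isEdge (p.isAscent_min hj)]
  rw [isBlock_iff_isEdge]
  refine and_congr (Set.ext_iff.trans (forall_congr' fun i => ?_))
    (Set.ext_iff.trans (forall_congr' fun j => ?_))
  · exact and_iff_left_iff_imp.trans (imp_congr_right fun _ =>
      exists_congr fun j => and_congr_right fun hj => hconj hj)
  · exact and_iff_left_iff_imp.trans (imp_congr_right fun hj =>
      exists_congr fun i => and_congr_right fun _ => hconj' hj)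

end Coset

namespace IsBlock

variable {y z : W n}

theorem min_cosetOf (h : IsBlock I J y) : (cosetOf I J y).min = y := by
  obtain ⟨u, hu, he⟩ := h.mem_cosetOf_iff.mp (cosetOf I J y).min_mem
  have hle := Coset.len_min_le (h.mem_cosetOf_iff.mpr ⟨1, one_mem _, (mul_one y).symm⟩)
  rw [he, h.len_mul hu] at hle
  rw [he, eq_one_of_len_eq_zero (w := u) (by omega), mul_one]

theorem max_cosetOf (h : IsBlock I J y) : (cosetOf I J y).max = y * longest J := by
  obtain ⟨u, hu, he⟩ := h.mem_cosetOf_iff.mp (cosetOf I J y).max_mem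
  rw [he]
  congr 1
  refine eq_longest hu fun j => not_isAscent_of_forall_len_le hu fun v hv => ?_
  have hle := Coset.len_le_len_max (h.mem_cosetOf_iff.mpr ⟨v, hv, rfl⟩)
  rw [he, h.len_mul hu, h.len_mul hv] at hle
  omega

theorem isCore_cosetOf (h : IsBlock I J y) : (cosetOf I J y).IsCore :=
  Coset.isCore_iff.mpr (h.min_cosetOf.symm ▸ h)

end IsBlock

namespace Coset

theorem IsCore.isBlock {p : Coset I J} (h : p.IsCore) : IsBlock I J p.min := isCore_iff.mp h

theorem IsCore.max_eq {p : Coset I J} (h : p.IsCore) : p.max = p.min * longest J := by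
  rw [← h.isBlock.max_cosetOf, ← eq_cosetOf_min]

variable {p : Coset I J} {q : Coset J K}

theorem IsCore.max_mul_longest_inv_mul_max (hp : p.IsCore) (hq : q.IsCore) :
    p.max * (longest J)⁻¹ * q.max = p.min * q.min * longest K := by
  rw [hp.max_eq, hq.max_eq, mul_inv_cancel_right, mul_assoc]

theorem IsReducedComp.comp_eq (hp : p.IsCore) (hq : q.IsCore) (h : p.IsReducedComp q) :
    p.comp q = cosetOf I K (p.min * q.min) := by
  refine (eq_cosetOf_of_mem ?_).symm
  rw [← h.1, hp.max_mul_longest_inv_mul_max hq]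
  exact (hp.isBlock.mul hq.isBlock).mem_cosetOf_iff.mpr ⟨_, longest_mem K, rfl⟩

theorem IsReducedComp.len_min_mul_min (hp : p.IsCore) (hq : q.IsCore) (h : p.IsReducedComp q) :
    len (p.min * q.min) = len p.min + len q.min := by
  have hlen := h.2.1
  rw [hp.max_mul_longest_inv_mul_max hq, (hp.isBlock.mul hq.isBlock).len_mul (longest_mem K),
    hp.max_eq, mul_inv_cancel_right, hq.max_eq, hq.isBlock.len_mul (longest_mem K)] at hlen
  omega

theorem IsReducedComp.isCore_comp (hp : p.IsCore) (hq : q.IsCore) (h : p.IsReducedComp q) :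
    (p.comp q).IsCore :=
  h.comp_eq hp hq ▸ (hp.isBlock.mul hq.isBlock).isCore_cosetOf

end Coset

theorem Coset.squash_cosetOf_min (k : ℕ) (p : Coset I J) :
    squash k (cosetOf I J p.min) = squash k p := by
  rw [← p.eq_cosetOf_min]

namespace IsBlock

variable {y : W n}

theorem card_add_eq (h : IsBlock I J y) (hJ : J.card + k = n) : I.card + k = n := by
  rw [h.card_eq, hJ]

theorem squash_label (h : IsBlock I J y) (hI : I.card + k = n) (hJ : J.card + k = n) (x : Pt n) :
    (squash k (cosetOf I J y)).1 (label J hJ x) = label I hI (y.1 x) := by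
  have hmin : IsBlock I J (cosetOf I J y).min := h.min_cosetOf.symm ▸ h
  unfold squash
  rw [dif_pos ⟨hI, hJ, hmin⟩]
  change squashPerm hI hJ hmin _ = _
  rw [squashPerm_label, h.min_cosetOf]

end IsBlock

theorem squash_one (hJ : J.card + k = n) : squash k (cosetOf J J (1 : W n)) = 1 := by
  refine W.ext fun c => ?_
  obtain ⟨x, rfl⟩ := label_surjective J hJ c
  exact (IsBlock.one J).squash_label hJ hJ x

namespace IsBlock

variable {y z : W n}

theorem squash_mul (h : IsBlock I J y) (h' : IsBlock J K z) (hJ : J.card + k = n) :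
    squash k (cosetOf I K (y * z)) = squash k (cosetOf I J y) * squash k (cosetOf J K z) := by
  have hI := h.card_add_eq hJ
  have hK := h'.inv.card_add_eq hJ
  refine W.ext fun c => ?_
  obtain ⟨x, rfl⟩ := label_surjective K hK c
  rw [W.mul_apply, (h.mul h').squash_label hI hK, h'.squash_label hJ hK, h.squash_label hI hJ,
    W.mul_apply]

theorem squash_inv (h : IsBlock I J y) (hJ : J.card + k = n) :
    squash k (cosetOf J I y⁻¹) = (squash k (cosetOf I J y))⁻¹ := by
  rw [eq_inv_iff_mul_eq_one, ← h.inv.squash_mul h (h.card_add_eq hJ), inv_mul_cancel,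
    squash_one hJ]

theorem eq_one_of_squash_eq_one (h : IsBlock I J y) (hJ : J.card + k = n)
    (hs : squash k (cosetOf I J y) = 1) : y = 1 ∧ I = J := by
  have hlabel (x : Pt n) : labelInt I (y.1 x) = labelInt J x := by
    have := h.squash_label (h.card_add_eq hJ) hJ x
    rw [hs] at this
    exact congrArg Subtype.val this.symm
  exact ⟨eq_one_of_labelInt_apply_eq hlabel fun _ => h.isAscent,
    (eq_and_mem_parabolic_of_labelInt_apply_eq hlabel).1⟩

theorem eq_of_squash_eq_of_target {J' : Finset (Fin n)} (h : IsBlock I J y) (h' : IsBlock I J' z)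
    (hI : I.card + k = n) (hs : squash k (cosetOf I J y) = squash k (cosetOf I J' z)) :
    y = z ∧ J = J' := by
  have hone : squash k (cosetOf J J' (y⁻¹ * z)) = 1 := by
    rw [h.inv.squash_mul h' hI, h.squash_inv (h.inv.card_add_eq hI), hs, inv_mul_cancel]
  obtain ⟨hyz, hJ⟩ := (h.inv.mul h').eq_one_of_squash_eq_one (h'.inv.card_add_eq hI) hone
  exact ⟨inv_mul_eq_one.mp hyz, hJ⟩

theorem eq_of_squash_eq_of_source {I' : Finset (Fin n)} (h : IsBlock I J y) (h' : IsBlock I' J z)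
    (hJ : J.card + k = n) (hs : squash k (cosetOf I J y) = squash k (cosetOf I' J z)) :
    y = z ∧ I = I' := by
  obtain ⟨hyz, hI⟩ := h.inv.eq_of_squash_eq_of_target h'.inv hJ
    (by rw [h.squash_inv hJ, h'.squash_inv hJ, hs])
  exact ⟨inv_injective hyz, hI⟩

/-- Block permutations create no inversions inside components, so the inversions of `z` that `y`
does or does not restore are seen on the labels. -/
theorem len_mul_eq_iff_squash (h : IsBlock I J y) (h' : IsBlock J K z) (hJ : J.card + k = n) :
    len (y * z) = len y + len z ↔
      len (squash k (cosetOf I J y) * squash k (cosetOf J K z)) =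
        len (squash k (cosetOf I J y)) + len (squash k (cosetOf J K z)) := by
  have hI := h.card_add_eq hJ
  have hK := h'.inv.card_add_eq hJ
  rw [len_mul_eq_iff, len_mul_eq_iff]
  constructor
  · intro hlen c d
    obtain ⟨⟨a, rfl⟩, b, rfl⟩ := And.intro (label_surjective K hK c) (label_surjective K hK d)
    rw [h'.squash_label hJ hK, h'.squash_label hJ hK, h.squash_label hI hJ, h.squash_label hI hJ]
    intro hab hba
    have hlt := hlen a b (lt_of_labelInt_lt hab) (lt_of_labelInt_lt hba)
    exact lt_of_le_of_ne (labelInt_mono I hlt.le) fun e =>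
      hba.ne (Subtype.ext ((h.labelInt_eq_iff _ _).mpr (congrArg Subtype.val e)))
  · intro hlen a b hab hba
    have hab' : labelInt K a ≠ labelInt K b := fun e => (h'.apply_lt_apply hab e).not_gt hba
    have hba' : labelInt J (z.1 b) ≠ labelInt J (z.1 a) := fun e =>
      hab' ((h'.labelInt_eq_iff _ _).mpr e.symm)
    have hlt := hlen (label K hK a) (label K hK b)
    rw [h'.squash_label hJ hK, h'.squash_label hJ hK, h.squash_label hI hJ,
      h.squash_label hI hJ] at hlt
    exact lt_of_labelInt_lt (hlt ((labelInt_mono K hab.le).lt_of_ne hab')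
      ((labelInt_mono J hba.le).lt_of_ne hba'))

end IsBlock

theorem gaps_lt_gaps {t : Fin n} (ht : t ∉ J) {a : ℕ} (h : t < a) : gaps J t < gaps J a := by
  have := gaps_mono J (show (t : ℕ) + 1 ≤ a from h)
  rw [gaps_succ, if_neg ht] at this
  omega

/-- The position, counted from `0`, of `s_t` among the simple reflections outside `J`. Adding `s_t`
to `J` merges the components with labels `gapIndex hJ ht` and `gapIndex hJ ht + 1`. -/
def gapIndex {t : Fin n} (hJ : J.card + k = n) (ht : t ∉ J) : Fin k :=
  ⟨gaps J t, by
    have h1 := gaps_lt_gaps ht t.2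
    have h2 := gaps_top J
    omega⟩

theorem gapIndex_inj {s t : Fin n} (hJ : J.card + k = n) {hs : s ∉ J} {ht : t ∉ J} :
    gapIndex hJ hs = gapIndex hJ ht ↔ s = t := by
  refine ⟨fun h => ?_, fun h => by subst h; rfl⟩
  have hval : gaps J s = gaps J t := congrArg Fin.val h
  obtain hlt | heq | hlt := lt_trichotomy s t
  · exact absurd hval (gaps_lt_gaps hs hlt).ne
  · exact heq
  · exact absurd hval (gaps_lt_gaps ht hlt).ne'

theorem exists_gapIndex_eq (hJ : J.card + k = n) (c : Fin k) :
    ∃ (t : Fin n) (ht : t ∉ J), gapIndex hJ ht = c := by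
  have hinj : Function.Injective fun t : {t // t ∈ Jᶜ} =>
      gapIndex hJ (Finset.mem_compl.mp t.2) :=
    fun s t h => Subtype.ext ((gapIndex_inj hJ).mp h)
  have hcard : Nat.card {t // t ∈ Jᶜ} = Nat.card (Fin k) := by
    rw [Nat.card_eq_fintype_card, Fintype.card_coe, Finset.card_compl, Fintype.card_fin,
      Nat.card_fin]
    omega
  obtain ⟨t, ht⟩ := ((Nat.bijective_iff_injective_and_card _).mpr ⟨hinj, hcard⟩).2 c
  exact ⟨t, _, ht⟩

theorem gaps_singleton_gaps {t : Fin n} (hJ : J.card + k = n) (ht : t ∉ J) {a : ℕ} (ha : a ≤ n) :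
    gaps {gapIndex hJ ht} (gaps J a) = gaps (insert t J) a := by
  induction a with
  | zero => rw [gaps_zero, gaps_zero, gaps_zero]
  | succ a ih =>
    have hstep := gaps_succ J ⟨a, ha⟩
    have hstep' := gaps_succ (insert t J) ⟨a, ha⟩
    specialize ih (by omega)
    by_cases hd : ⟨a, ha⟩ ∈ J
    · rw [if_pos hd] at hstep
      rw [if_pos (Finset.mem_insert_of_mem hd)] at hstep'
      rw [hstep, hstep', ih]
    · have hgap := gaps_succ {gapIndex hJ ht} (gapIndex hJ hd)
      simp only [Finset.mem_singleton, gapIndex_inj] at hgap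
      simp only [Finset.mem_insert, hd, or_false] at hstep'
      rw [if_neg hd] at hstep
      rw [hstep, hstep', ← ih]
      exact hgap

theorem labelInt_singleton_label {t : Fin n} (hJ : J.card + k = n) (ht : t ∉ J) (x : Pt n) :
    labelInt {gapIndex hJ ht} (label J hJ x) = labelInt (insert t J) x := by
  have hx := abs_le.mp x.2
  have hgaps := gaps_singleton_gaps hJ ht (a := x.1.natAbs) (by omega)
  have hval : (label J hJ x).1 = labelInt J x := rfl
  obtain h | h := le_total 0 x.1
  · rw [labelInt_of_nonneg J h] at hval
    rw [labelInt_of_nonneg _ h, labelInt_of_nonneg _ (by omega), hval, Int.natAbs_natCast, hgaps]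
  · rw [labelInt_of_nonpos J h] at hval
    rw [labelInt_of_nonpos _ h, labelInt_of_nonpos _ (by omega), hval, Int.natAbs_neg,
      Int.natAbs_natCast, hgaps]

theorem eq_one_or_eq_simple_of_mem_parabolic_singleton {c : Fin n} {w : W n}
    (h : w ∈ parabolic {c}) : w = 1 ∨ w = simple c := by
  have key {u : W n} (hu : u ∈ parabolic {c}) (hasc : IsAscent u c) : u = 1 :=
    eq_one_of_labelInt_apply_eq (labelInt_apply_of_mem_parabolic hu) fun j hj =>
      Finset.mem_singleton.mp hj ▸ hasc
  by_cases hasc : IsAscent w c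
  · exact Or.inl (key h hasc)
  · have hone := key (mul_mem h (simple_mem_parabolic (Finset.mem_singleton_self c)))
      (isAscent_mul_simple_iff.mpr hasc)
    exact Or.inr (by rw [eq_inv_of_mul_eq_one_left hone, simple_inv])

theorem parabolic_mono (h : I ⊆ J) : parabolic I ≤ parabolic J :=
  Subgroup.closure_mono (Set.image_mono h)

theorem isStep_iff_covBy : IsStep I K ↔ I ⋖ K ∨ K ⋖ I := by
  refine or_congr ?_ ?_
  · simp only [Finset.covBy_iff_exists_insert, eq_comm]
  · simp only [Finset.covBy_iff_exists_erase, eq_comm]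

/-- The reflection `x ↦ -x` through the origin, which is the longest element of `W n`; it turns
the order reversing maps `w_J` into order preserving ones. -/
def negation (n : ℕ) : W n := ⟨⟨Neg.neg, Neg.neg, Pt.neg_neg, Pt.neg_neg⟩, fun _ => rfl⟩

theorem negation_apply (x : Pt n) : (negation n).1 x = -x := rfl

theorem isBlock_longest_mul_negation (J : Finset (Fin n)) :
    IsBlock J J (longest J * negation n) := by
  refine isBlock_iff_labelInt.mpr ⟨fun a b => ?_, fun a b hab hl => ?_⟩
  · simp only [W.mul_apply, negation_apply, labelInt_longest_apply, labelInt_neg, neg_inj]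
  · rw [W.mul_apply, W.mul_apply, negation_apply, negation_apply]
    refine longest_apply_lt (Pt.neg_lt_neg_iff.mpr hab) ?_
    rw [labelInt_neg, labelInt_neg, hl]

theorem IsEdge.longest_apply {j : Fin n} {a b : Pt n} (h : IsEdge j a b) (hj : j ∈ J) :
    ∃ i ∈ J, IsEdge i ((longest J).1 b) ((longest J).1 a) := by
  obtain ⟨i, hi, hedge⟩ := (isBlock_longest_mul_negation J).exists_isEdge hj
  refine ⟨i, hi, ?_⟩
  have := (hedge.map h).neg
  rwa [W.mul_apply, W.mul_apply, negation_apply, negation_apply, W.apply_neg, W.apply_neg,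
    Pt.neg_neg, Pt.neg_neg] at this

/-- `y` is the minimal element of an atomic `(I, J)`-coset with reduced expression `[I, K, J]`;
the last condition says that its maximal element is `w_K`. -/
structure IsAtomicBlock (I K J : Finset (Fin n)) (y : W n) : Prop where
  block : IsBlock I J y
  source_covBy : J ⋖ K
  target_covBy : I ⋖ K
  mul_longest_eq : y * longest J = longest K

theorem exists_isAtomicBlock (h : J ⋖ K) : ∃ I y, IsAtomicBlock I K J y := by
  classical
  let y := longest K * longest J
  let I := K.filter fun i => ∃ j ∈ J, IsEdge i (y.1 (pt j)) (y.1 (ptSucc j))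
  have hblock : IsBlock I J y := by
    refine isBlock_iff_isEdge.mpr ⟨fun i hi => (Finset.mem_filter.mp hi).2, fun j hj => ?_⟩
    obtain ⟨i, hi, hedge⟩ := (isEdge_pt j).longest_apply hj
    obtain ⟨i', hi', hedge'⟩ := hedge.longest_apply (h.le hi)
    exact ⟨i', Finset.mem_filter.mpr ⟨hi', j, hj, hedge'⟩, hedge'⟩
  have hcard : I.card + 1 = K.card := by
    obtain ⟨t, ht, rfl⟩ := Finset.covBy_iff_exists_insert.mp h
    rw [hblock.card_eq, Finset.card_insert_of_notMem ht]
  refine ⟨I, y, hblock, h, ?_, by rw [mul_assoc, longest_mul_self, mul_one]⟩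
  exact Finset.covBy_iff_exists_insert.mpr
    (Finset.exists_eq_insert_iff.mpr ⟨Finset.filter_subset _ _, hcard⟩)

namespace IsAtomicBlock

variable {y : W n}

theorem inv (h : IsAtomicBlock I K J y) : IsAtomicBlock J K I y⁻¹ where
  block := h.block.inv
  source_covBy := h.target_covBy
  target_covBy := h.source_covBy
  mul_longest_eq := by
    rw [← longest_inv I, ← mul_inv_rev, ← h.block.mul_longest, h.mul_longest_eq, longest_inv]

theorem eq_longest_mul (h : IsAtomicBlock I K J y) : y = longest K * longest J := by
  rw [← h.mul_longest_eq, mul_assoc, longest_mul_self, mul_one]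

theorem mem_parabolic (h : IsAtomicBlock I K J y) : y ∈ parabolic K :=
  h.eq_longest_mul ▸ mul_mem (longest_mem K) (parabolic_mono h.source_covBy.le (longest_mem J))

theorem ne_one (h : IsAtomicBlock I K J y) : y ≠ 1 := fun hy =>
  h.source_covBy.ne (longest_injective (by rw [← h.mul_longest_eq, hy, one_mul]))

theorem cosetOf_longest (h : IsAtomicBlock I K J y) : cosetOf I J (longest K) = cosetOf I J y :=
  (Coset.eq_cosetOf_of_mem (h.block.mem_cosetOf_iff.mpr
    ⟨_, longest_mem J, h.mul_longest_eq.symm⟩)).symm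

/-- `K` merges the components of `I` with labels `c', c' + 1` and those of `J` with labels
`c, c + 1`. Since `y` lies in `W_K`, its squash sends the merged components of label `p` for `c` to
those of label `p` for `c'`, which forces `c' = c`. -/
theorem squash_eq_simple {t : Fin n} (h : IsAtomicBlock I (insert t J) J y)
    (hJ : J.card + k = n) (ht : t ∉ J) :
    squash k (cosetOf I J y) = simple (gapIndex hJ ht) := by
  have hI := h.block.card_add_eq hJ
  obtain ⟨s, hs, hK⟩ := Finset.covBy_iff_exists_insert.mp h.target_covBy
  have hlabel (c : Pt k) : labelInt {gapIndex hI hs} ((squash k (cosetOf I J y)).1 c) =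
      labelInt {gapIndex hJ ht} c := by
    obtain ⟨x, rfl⟩ := label_surjective J hJ c
    rw [h.block.squash_label hI hJ, labelInt_singleton_label, labelInt_singleton_label, hK,
      labelInt_apply_of_mem_parabolic h.mem_parabolic]
  have hmem := (eq_and_mem_parabolic_of_labelInt_apply_eq hlabel).2
  exact (eq_one_or_eq_simple_of_mem_parabolic_singleton hmem).resolve_left fun hone =>
    h.ne_one (h.block.eq_one_of_squash_eq_one hJ hone).1

theorem exists_squash_eq_simple (h : IsAtomicBlock I K J y) (hJ : J.card + k = n) :
    ∃ c : Fin k, squash k (cosetOf I J y) = simple c := by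
  obtain ⟨t, ht, rfl⟩ := Finset.covBy_iff_exists_insert.mp h.source_covBy
  exact ⟨_, h.squash_eq_simple hJ ht⟩

theorem longest_mul_stepProd_cons (h : IsAtomicBlock I K J y) (L : List (Finset (Fin n))) :
    longest I * stepProd (I :: K :: J :: L) = y * (longest J * stepProd (J :: L)) := by
  rw [stepProd, stepProd, if_pos h.target_covBy.le, if_neg h.source_covBy.lt.not_ge, one_mul,
    mul_assoc, mul_inv_cancel_left, ← h.mul_longest_eq, mul_assoc]

theorem len_longest_add_stepLen_cons (h : IsAtomicBlock I K J y) (L : List (Finset (Fin n))) :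
    len (longest I) + stepLen (I :: K :: J :: L) =
      len y + (len (longest J) + stepLen (J :: L)) := by
  rw [stepLen, stepLen, if_pos h.target_covBy.le, if_neg h.source_covBy.lt.not_ge,
    ← h.mul_longest_eq, h.block.len_mul (longest_mem J)]
  push_cast
  ring

theorem squashExpr_cons (h : IsAtomicBlock I K J y) (k : ℕ) (L : List (Finset (Fin n))) :
    squashExpr k (I :: K :: J :: L) = squash k (cosetOf I J y) :: squashExpr k (J :: L) := by
  rw [squashExpr, h.cosetOf_longest]

end IsAtomicBlock

theorem exists_isAtomicBlock_squash_eq_simple (hJ : J.card + k = n) (c : Fin k) :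
    ∃ I K y, IsAtomicBlock I K J y ∧ squash k (cosetOf I J y) = simple c := by
  obtain ⟨t, ht, rfl⟩ := exists_gapIndex_eq hJ c
  obtain ⟨I, y, h⟩ := exists_isAtomicBlock (Finset.covBy_insert ht)
  exact ⟨I, _, y, h, h.squash_eq_simple hJ ht⟩

/-- An expression `[I, K, J]` of a core coset cannot first descend: its minimal element would be
`w_I w_K`, an element of `W_I` without inversions inside the components of `I`. -/
theorem Coset.IsCore.isReducedExpr_iff {p : Coset I J} (hp : p.IsCore) :
    IsReducedExpr p [I, K, J] ↔ IsAtomicBlock I K J p.min := by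
  constructor
  · rintro ⟨⟨-, -, hchain⟩, hprod, -⟩
    simp only [List.isChain_cons_cons, isStep_iff_covBy] at hchain
    obtain ⟨hIK, hKJ, -⟩ := hchain
    have hIJ : ¬I < J := fun h => (Finset.card_lt_card h).ne hp.isBlock.card_eq
    have hJI : ¬J < I := fun h => (Finset.card_lt_card h).ne' hp.isBlock.card_eq
    simp only [stepProd, hp.max_eq, mul_one] at hprod
    obtain hIK | hKI := hIK
    · have hJK := hKJ.resolve_left fun h => hIJ (hIK.lt.trans h.lt)
      rw [if_pos hIK.le, if_neg hJK.lt.not_ge, mul_one, mul_inv_cancel_left] at hprod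
      exact ⟨hp.isBlock, hJK, hIK, hprod⟩
    · have hKJ := hKJ.resolve_right fun h => hJI (h.lt.trans hKI.lt)
      rw [if_neg hKI.lt.not_ge, if_pos hKJ.le, one_mul, ← mul_assoc, mul_left_inj] at hprod
      have hmem : p.min⁻¹ ∈ parabolic I := inv_mem <| hprod ▸
        mul_mem (longest_mem I) (inv_mem (parabolic_mono hKI.le (longest_mem K)))
      have hone : p.min⁻¹ = 1 := eq_one_of_labelInt_apply_eq (labelInt_apply_of_mem_parabolic hmem)
        fun _ => hp.isBlock.inv.isAscent
      rw [inv_eq_one.mp hone, eq_comm, mul_inv_eq_one] at hprod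
      exact absurd (longest_injective hprod) hKI.ne'
  · intro h
    refine ⟨⟨rfl, rfl, ?_⟩, ?_, ?_⟩
    · simp [isStep_iff_covBy, h.source_covBy, h.target_covBy]
    · rw [h.longest_mul_stepProd_cons, hp.max_eq]
      simp [stepProd]
    · rw [h.len_longest_add_stepLen_cons, hp.max_eq, hp.isBlock.len_mul (longest_mem J)]
      simp [stepLen]

theorem Coset.isAtomic_iff {p : Coset I J} :
    p.IsAtomic ↔ ∃ K, IsAtomicBlock I K J p.min := by
  constructor
  · rintro ⟨hp, s, t, -, -, h⟩
    obtain rfl : (insert s I).erase t = J := by simpa using h.1.2.1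
    exact ⟨_, hp.isReducedExpr_iff.mp h⟩
  · rintro ⟨K, h⟩
    obtain ⟨s, hs, rfl⟩ := Finset.covBy_iff_exists_insert.mp h.target_covBy
    obtain ⟨t, ht, hJ⟩ := Finset.covBy_iff_exists_erase.mp h.source_covBy
    have hp := Coset.isCore_iff.mpr h.block
    exact ⟨hp, s, t, hs, ht, hJ.symm ▸ hp.isReducedExpr_iff.mpr h⟩

/-- `I :: L` is a concatenation of expressions `[I', K', J']` of atomic cosets leading from `I` to
`J`, and `y` is the product of the minimal elements of these cosets. -/
inductive IsAtomicPath : Finset (Fin n) → Finset (Fin n) → List (Finset (Fin n)) → W n → Prop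
  | nil (I : Finset (Fin n)) : IsAtomicPath I I [] 1
  | cons {I K I' J : Finset (Fin n)} {L : List (Finset (Fin n))} {y z : W n}
      (hy : IsAtomicBlock I K I' y) (hz : IsAtomicPath I' J L z) :
      IsAtomicPath I J (K :: I' :: L) (y * z)

theorem IsAtomicExpr.exists_isAtomicPath {L : List (Finset (Fin n))} (h : IsAtomicExpr L) :
    ∃ I J L' y, L = I :: L' ∧ IsAtomicPath I J L' y := by
  induction h with
  | base I => exact ⟨I, I, [], 1, rfl, .nil I⟩
  | cons I K I' L a ha hK _ ih =>
    obtain ⟨_, J, _, z, ⟨rfl, rfl⟩, hz⟩ := ih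
    exact ⟨I, J, _, _, rfl, .cons (ha.1.isReducedExpr_iff.mp hK) hz⟩

namespace IsAtomicPath

variable {L : List (Finset (Fin n))} {y : W n}

theorem isAtomicExpr (h : IsAtomicPath I J L y) : IsAtomicExpr (I :: L) := by
  induction h with
  | nil I => exact .base I
  | cons hy _ ih =>
    have hmin := hy.block.min_cosetOf.symm ▸ hy
    exact .cons _ _ _ _ _ (Coset.isAtomic_iff.mpr ⟨_, hmin⟩)
      (hy.block.isCore_cosetOf.isReducedExpr_iff.mpr hmin) ih

theorem isExpr (h : IsAtomicPath I J L y) : IsExpr I J (I :: L) := by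
  induction h with
  | nil I => exact ⟨rfl, rfl, List.isChain_singleton I⟩
  | cons hy _ ih =>
    refine ⟨rfl, by simpa using ih.2.1, ?_⟩
    simp only [List.isChain_cons_cons, isStep_iff_covBy]
    exact ⟨Or.inl hy.target_covBy, Or.inr hy.source_covBy, ih.2.2⟩

theorem isBlock (h : IsAtomicPath I J L y) : IsBlock I J y := by
  induction h with
  | nil I => exact .one I
  | cons hy _ ih => exact hy.block.mul ih

theorem longest_mul_stepProd (h : IsAtomicPath I J L y) :
    longest I * stepProd (I :: L) = y * longest J := by
  induction h with
  | nil I => simp [stepProd]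
  | cons hy _ ih => rw [hy.longest_mul_stepProd_cons, ih, mul_assoc]

theorem squash_eq_prod (h : IsAtomicPath I J L y) (hI : I.card + k = n) :
    squash k (cosetOf I J y) = (squashExpr k (I :: L)).prod := by
  induction h with
  | nil I => simp [squash_one hI, squashExpr]
  | cons hy hz ih =>
    have hI' := hy.inv.block.card_add_eq hI
    rw [hy.squashExpr_cons, List.prod_cons, hy.block.squash_mul hz.isBlock hI', ih hI']

theorem exists_map_simple_eq (h : IsAtomicPath I J L y) (hI : I.card + k = n) :
    ∃ ω : List (Fin k), ω.map simple = squashExpr k (I :: L) := by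
  induction h with
  | nil I => exact ⟨[], rfl⟩
  | cons hy _ ih =>
    have hI' := hy.inv.block.card_add_eq hI
    obtain ⟨c, hc⟩ := hy.exists_squash_eq_simple hI'
    obtain ⟨ω, hω⟩ := ih hI'
    exact ⟨c :: ω, by rw [hy.squashExpr_cons, List.map_cons, hc, hω]⟩

theorem len_squash_le (h : IsAtomicPath I J L y) (hI : I.card + k = n) :
    len (squash k (cosetOf I J y)) ≤ (squashExpr k (I :: L)).length := by
  obtain ⟨ω, hω⟩ := h.exists_map_simple_eq hI
  rw [h.squash_eq_prod hI, ← hω, List.length_map]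
  exact len_prod_le ω

theorem len_add_len_longest_le (h : IsAtomicPath I J L y) :
    len y + len (longest J) ≤ len (longest I) + stepLen (I :: L) := by
  induction h with
  | nil I => simp [stepLen, len_one]
  | @cons _ _ _ _ _ y z hy _ ih =>
    have := len_mul_le y z
    rw [hy.len_longest_add_stepLen_cons]
    omega

theorem len_add_len_longest_eq_iff (h : IsAtomicPath I J L y) (hI : I.card + k = n) :
    len y + len (longest J) = len (longest I) + stepLen (I :: L) ↔
      (squashExpr k (I :: L)).length = len (squash k (cosetOf I J y)) := by
  induction h with
  | nil I => simp [stepLen, squashExpr, squash_one hI, len_one]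
  | @cons _ _ I' J _ y z hy hz ih =>
    have hI' := hy.inv.block.card_add_eq hI
    have hmul := hy.block.len_mul_eq_iff_squash hz.isBlock hI'
    obtain ⟨c, hc⟩ := hy.exists_squash_eq_simple hI'
    have hle := len_mul_le y z
    have hle' := hz.len_add_len_longest_le
    have hsle := len_mul_le (simple c) (squash k (cosetOf I' J z))
    have hsle' := hz.len_squash_le hI'
    specialize ih hI'
    rw [hc, len_simple] at hmul
    rw [len_simple] at hsle
    rw [hy.len_longest_add_stepLen_cons, hy.squashExpr_cons, List.length_cons,
      hy.block.squash_mul hz.isBlock hI', hc]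
    omega

theorem isOrdinaryReducedExpr_iff (h : IsAtomicPath I J L y) (hI : I.card + k = n) :
    IsOrdinaryReducedExpr (squash k (cosetOf I J y)) (squashExpr k (I :: L)) ↔
      len y + len (longest J) = len (longest I) + stepLen (I :: L) := by
  rw [h.len_add_len_longest_eq_iff hI]
  refine ⟨fun hω => hω.2.2, fun hlen => ⟨?_, (h.squash_eq_prod hI).symm, hlen⟩⟩
  obtain ⟨ω, hω⟩ := h.exists_map_simple_eq hI
  rw [← hω, List.forall_mem_map]
  exact fun c _ => ⟨c, rfl⟩

theorem eq_of_squashExpr_eq {J' : Finset (Fin n)} {L' : List (Finset (Fin n))} {y' : W n}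
    (h : IsAtomicPath I J L y) (h' : IsAtomicPath I J' L' y') (hI : I.card + k = n)
    (hs : squashExpr k (I :: L) = squashExpr k (I :: L')) : L = L' := by
  induction h generalizing L' y' with
  | nil I =>
    cases h' with
    | nil => rfl
    | cons hy' hz' => simp [squashExpr] at hs
  | cons hy _ ih =>
    cases h' with
    | nil => simp [squashExpr] at hs
    | cons hy' hz' =>
      rw [hy.squashExpr_cons, hy'.squashExpr_cons, List.cons.injEq] at hs
      obtain ⟨rfl, rfl⟩ := hy.block.eq_of_squash_eq_of_target hy'.block hI hs.1
      obtain rfl := longest_injective (hy.mul_longest_eq.symm.trans hy'.mul_longest_eq)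
      rw [ih hz' (hy.inv.block.card_add_eq hI) hs.2]

end IsAtomicPath

theorem exists_isAtomicPath (hI : I.card + k = n) (ω : List (Fin k)) :
    ∃ J L y, IsAtomicPath I J L y ∧ squashExpr k (I :: L) = ω.map simple := by
  induction ω generalizing I with
  | nil => exact ⟨I, [], 1, .nil I, rfl⟩
  | cons c ω ih =>
    obtain ⟨I', K, y, hy, hc⟩ := exists_isAtomicBlock_squash_eq_simple hI c
    obtain ⟨J, L, z, hz, hω⟩ := ih (hy.block.card_add_eq hI)
    refine ⟨J, _, _, .cons hy.inv hz, ?_⟩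
    rw [hy.inv.squashExpr_cons, hy.block.squash_inv hI, hc, simple_inv, hω, List.map_cons]

theorem exists_isBlock_squash_eq (hJ : J.card + k = n) (σ : W k) :
    ∃ I y, IsBlock I J y ∧ squash k (cosetOf I J y) = σ := by
  obtain ⟨ω, hω⟩ := exists_word σ⁻¹
  obtain ⟨I, L, y, h, hL⟩ := exists_isAtomicPath hJ ω
  refine ⟨I, y⁻¹, h.isBlock.inv, ?_⟩
  rw [h.isBlock.squash_inv (h.isBlock.inv.card_add_eq hJ), h.squash_eq_prod hJ, hL, hω, inv_inv]

theorem bijOn_squash_isCore (hJ : J.card + k = n) :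
    Set.BijOn (fun q : Σ I : Finset (Fin n), Coset I J => squash k q.2) {q | q.2.IsCore}
      Set.univ := by
  refine ⟨Set.mapsTo_univ _ _, ?_, fun σ _ => ?_⟩
  · rintro ⟨I, p⟩ (hp : p.IsCore) ⟨I', q⟩ (hq : q.IsCore) (h : squash k p = squash k q)
    rw [← p.squash_cosetOf_min, ← q.squash_cosetOf_min] at h
    obtain ⟨hmin, rfl⟩ := hp.isBlock.eq_of_squash_eq_of_source hq.isBlock hJ h
    rw [p.eq_cosetOf_min, q.eq_cosetOf_min, hmin]
  · obtain ⟨I, y, h, hσ⟩ := exists_isBlock_squash_eq hJ σ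
    exact ⟨⟨I, cosetOf I J y⟩, h.isCore_cosetOf, hσ⟩

theorem bijOn_squash_isAtomic (hJ : J.card + k = n) :
    Set.BijOn (fun q : Σ I : Finset (Fin n), Coset I J => squash k q.2) {q | q.2.IsAtomic}
      (Set.range (simple : Fin k → W k)) := by
  refine ⟨?_, (bijOn_squash_isCore hJ).injOn.mono fun q hq => hq.1, ?_⟩
  · rintro ⟨I, p⟩ (hp : p.IsAtomic)
    obtain ⟨K, h⟩ := Coset.isAtomic_iff.mp hp
    obtain ⟨c, hc⟩ := h.exists_squash_eq_simple hJ
    exact ⟨c, by rw [← hc, p.squash_cosetOf_min]⟩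
  · rintro _ ⟨c, rfl⟩
    obtain ⟨I, K, y, h, hc⟩ := exists_isAtomicBlock_squash_eq_simple hJ c
    exact ⟨⟨I, cosetOf I J y⟩, Coset.isAtomic_iff.mpr ⟨K, h.block.min_cosetOf.symm ▸ h⟩, hc⟩

namespace Coset

theorem IsReducedComp.squash_comp {p : Coset I J} {q : Coset J K} (hp : p.IsCore)
    (hq : q.IsCore) (h : p.IsReducedComp q) (hJ : J.card + k = n) :
    squash k (p.comp q) = squash k p * squash k q := by
  rw [h.comp_eq hp hq, hp.isBlock.squash_mul hq.isBlock hJ, p.squash_cosetOf_min,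
    q.squash_cosetOf_min]

theorem IsReducedComp.len_squash_mul_squash {p : Coset I J} {q : Coset J K} (hp : p.IsCore)
    (hq : q.IsCore) (h : p.IsReducedComp q) (hJ : J.card + k = n) :
    len (squash k p * squash k q) = len (squash k p) + len (squash k q) := by
  have := (hp.isBlock.len_mul_eq_iff_squash hq.isBlock hJ).mp (h.len_min_mul_min hp hq)
  rwa [p.squash_cosetOf_min, q.squash_cosetOf_min] at this

theorem IsCore.isAtomicReducedExpr_iff {p : Coset I J} (hp : p.IsCore) (hJ : J.card + k = n)
    {M : List (Finset (Fin n))} :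
    IsAtomicReducedExpr p M ↔ ∃ L, M = I :: L ∧ IsAtomicPath I J L p.min ∧
      IsOrdinaryReducedExpr (squash k p) (squashExpr k M) := by
  have hI := hp.isBlock.card_add_eq hJ
  have hlen : (len p.max : ℤ) = len p.min + len (longest J) := by
    rw [hp.max_eq, hp.isBlock.len_mul (longest_mem J), Nat.cast_add]
  rw [← p.squash_cosetOf_min]
  constructor
  · rintro ⟨⟨hexpr, hmax, hmaxlen⟩, hM⟩
    obtain ⟨_, _, L, y, rfl, h⟩ := hM.exists_isAtomicPath
    obtain rfl := Option.some_injective _ (h.isExpr.1.symm.trans hexpr.1)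
    obtain rfl := Option.some_injective _ (h.isExpr.2.1.symm.trans hexpr.2.1)
    rw [h.longest_mul_stepProd, hp.max_eq, mul_left_inj] at hmax
    subst hmax
    exact ⟨L, rfl, h, (h.isOrdinaryReducedExpr_iff hI).mpr (hlen ▸ hmaxlen)⟩
  · rintro ⟨L, rfl, h, hω⟩
    exact ⟨⟨h.isExpr, by rw [hp.max_eq, h.longest_mul_stepProd],
      hlen.trans ((h.isOrdinaryReducedExpr_iff hI).mp hω)⟩, h.isAtomicExpr⟩

theorem IsCore.bijOn_squashExpr {p : Coset I J} (hp : p.IsCore) (hJ : J.card + k = n) :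
    Set.BijOn (squashExpr k) {L | IsAtomicReducedExpr p L}
      {ω | IsOrdinaryReducedExpr (squash k p) ω} := by
  have hI := hp.isBlock.card_add_eq hJ
  refine ⟨fun M hM => ?_, fun M hM M' hM' hs => ?_, fun ω hω => ?_⟩
  · obtain ⟨L, -, -, hL⟩ := (hp.isAtomicReducedExpr_iff hJ).mp hM
    exact hL
  · obtain ⟨L, rfl, hL, -⟩ := (hp.isAtomicReducedExpr_iff hJ).mp hM
    obtain ⟨L', rfl, hL', -⟩ := (hp.isAtomicReducedExpr_iff hJ).mp hM'
    rw [hL.eq_of_squashExpr_eq hL' hI hs]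
  · obtain ⟨ω, rfl⟩ := (Set.range_list_map (simple (n := k))).superset hω.1
    obtain ⟨J', L, y, hL, hs⟩ := exists_isAtomicPath hI ω
    obtain ⟨rfl, rfl⟩ := hp.isBlock.eq_of_squash_eq_of_target hL.isBlock hI
      (by rw [p.squash_cosetOf_min, hL.squash_eq_prod hI, hs, hω.2.1])
    exact ⟨I :: L, (hp.isAtomicReducedExpr_iff hJ).mpr ⟨L, rfl, hL, hs ▸ hω⟩, hs⟩

end Coset

end TypeB

end

theorem mainTheorem7 (n m k : ℕ) (J : Finset (Fin n)) (hm : J.card = m) (hk : k = n - m) :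
    -- minimal elements of core cosets are block permutations, so that squashing makes sense
    (∀ (I : Finset (Fin n)) (p : TypeB.Coset I J), p.IsCore →
      I.card = m ∧ TypeB.IsBlock I J p.min) ∧
    -- reduced compositions of core cosets are sent to reduced compositions
    (∀ (I K : Finset (Fin n)) (p' : TypeB.Coset I J) (p'' : TypeB.Coset J K),
      p'.IsCore → p''.IsCore → p'.IsReducedComp p'' →
      (p'.comp p'').IsCore ∧
      TypeB.squash k (p'.comp p'') = TypeB.squash k p' * TypeB.squash k p'' ∧
      TypeB.len (TypeB.squash k p' * TypeB.squash k p'') =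
        TypeB.len (TypeB.squash k p') + TypeB.len (TypeB.squash k p'')) ∧
    -- squashing is a bijection from the pairs `(I, p)` with `p` core to `W_k`
    Set.BijOn (fun q : (Σ I : Finset (Fin n), TypeB.Coset I J) => TypeB.squash k q.2)
      {q | q.2.IsCore} Set.univ ∧
    -- it restricts to a bijection from atomic cosets to simple reflections
    Set.BijOn (fun q : (Σ I : Finset (Fin n), TypeB.Coset I J) => TypeB.squash k q.2)
      {q | q.2.IsAtomic} (Set.range (TypeB.simple : Fin k → TypeB.W k)) ∧
    -- atomic reduced expressions correspond bijectively to ordinary reduced expressions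
    (∀ (I : Finset (Fin n)) (p : TypeB.Coset I J), p.IsCore →
      Set.BijOn (TypeB.squashExpr k) {L | TypeB.IsAtomicReducedExpr p L}
        {ω | TypeB.IsOrdinaryReducedExpr (TypeB.squash k p) ω}) := by
  have hJ : J.card + k = n := by
    have := Finset.card_le_univ J
    rw [Fintype.card_fin] at this
    omega
  exact ⟨fun I p hp => ⟨hp.isBlock.card_eq.trans hm, hp.isBlock⟩,
    fun I K p' p'' hp' hp'' h =>
      ⟨h.isCore_comp hp' hp'', h.squash_comp hp' hp'' hJ, h.len_squash_mul_squash hp' hp'' hJ⟩,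
    TypeB.bijOn_squash_isCore hJ, TypeB.bijOn_squash_isAtomic hJ,
    fun I p hp => hp.bijOn_squashExpr hJ⟩
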